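/- Let $f:\mathbb{R}^n\to\mathbb{R}$ and $g_1,\dots,g_{m_I}:\mathbb{R}^n\to\mathbb{R}$ be convex and continuously differentiable, $A\in\mathbb{R}^{m_E\times n}$, $b\in\mathbb{R}^{m_E}$, and let $x^*$ be an optimal solution of $$\min_x f(x)\quad\text{s.t. } g_i(x)\le 0\ (1\le i\le m_I),\quad Ax=b .$$ Put $\mathcal I=\{i: g_i(x^*)=0\}$ and assume that $|\mathcal I|+m_E>0$ and that LICQ holds at $x^*$: the gradients $\nabla g_i(x^*)$, $i\in\mathcal I$, together with the rows of $A$ are linearly independent. Let $B$ be the matrix with these vectors as rows and let $\kappa=\lambda_{\min}(BB^T)$. Write $\|\cdot\|$ for the Euclidean norm of vectors and the spectral norm of matrices, and $[a]_+=\max\{a,0\}$. Then there are unique multipliers $\lambda^*\in\mathbb{R}^{m_I}$, $\nu^*\in\mathbb{R}^{m_E}$ such that $z^*=(x^*,\lambda^*,\nu^*)$ satisfies the KKT conditions, and there is a function $\beta\mapsto M_\beta>0$ on $(0,\infty)$, depending only on the problem $(f,g,A,b)$, with $\lim_{\beta\to0^+}M_\beta=1$, such that the following holds. Let $\mu,\rho>0$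 and $\ell\ge 0$, let $f$ be $\mu$-strongly convex with $\ell$-Lipschitz gradient, and let $z(t)=(x(t),\lambda(t),\nu(t))$, $t\ge0$, be a differentiable solution, with $\lambda(0)\ge0$, of the augmented primal-dual gradient dynamics $$\dot x=-\nabla f(x)-A^T\nu-\sum_{i}[\rho g_i(x)+\lambda_i]_+\nabla g_i(x),\qquad \dot\lambda_i=\frac{[\rho g_i(x)+\lambda_i]_+-\lambda_i}{\rho},\qquad \dot\nu=Ax-b .$$ Let $d_0=\|z(0)-z^*\|$ and let $L_{g,i},M_{g,i}\ge0$ be such that on the ball $\{y:\|y-x^*\|\le d_0\}$ one has $\|\nabla g_i\|\le L_{g,i}$ and $\nabla g_i$ is $M_{g,i}$-Lipschitz, for every $i$. Put $L_g=(\sum_i L_{g,i}^2)^{1/2}$, $M_g=(\sum_i M_{g,i}^2)^{1/2}$, $$M_\Theta=\rho L_g^2+(\rho L_g d_0+d_0+\|\lambda^*\|)M_g,\qquad \delta_{\min}=1-\Big[1+\frac{\rho\max_{i\notin\mathcal I}g_i(x^*)}{d_0}\Big]_+^2,$$ with $\delta_{\min}=1$ if every constraint $g_i$ is active at $x^*$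 or if $d_0=0$. Then for every $\beta>0$ that satisfies $$\beta\le\frac{\kappa\,\delta_{\min}}{46\rho(L_g^2+\|A\|^2)}\quad\text{and}\quad \frac{\kappa\mu}{4\beta}-4\beta^2\ \ge\ \|A\|^2+L_g^2+\frac{\kappa}{4}+(\ell+M_\Theta)\Big(\mu+M_\Theta+\frac1\rho\Big)+\frac1{2\rho^2}$$ one has $$\|z(t)-z^*\|\le M_\beta\,e^{-\beta t}\,\|z(0)-z^*\|\qquad\text{for all }t\ge0 .$$ -/

import Mathlib

open Set Filter Topology
open scoped NNReal Matrix Matrix.Norms.L2Operator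

noncomputable section

namespace AugPDGD

/-- `ℝ^p` with the Euclidean norm. -/
abbrev E (p : ℕ) : Type := EuclideanSpace ℝ (Fin p)

/-- The data of the problem: minimize `f x` subject to `g i x ≤ 0` for all `i`, and `A x = b`. -/
structure Problem (n mI mE : ℕ) where
  /-- the objective -/
  f : E n → ℝ
  /-- the inequality constraint functions -/
  g : Fin mI → E n → ℝ
  /-- the matrix of the equality constraints -/
  A : Matrix (Fin mE) (Fin n) ℝ
  /-- the right-hand side of the equality constraints -/
  b : E mE

variable {n mI mE : ℕ}

namespace Problem

/-- `A x`. -/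
def mulA (P : Problem n mI mE) (x : E n) : E mE := WithLp.toLp 2 (P.A *ᵥ x.ofLp)

/-- `Aᵀ ν`. -/
def mulAT (P : Problem n mI mE) (ν : E mE) : E n := WithLp.toLp 2 (P.Aᵀ *ᵥ ν.ofLp)

/-- `x` satisfies all the constraints. -/
def Feasible (P : Problem n mI mE) (x : E n) : Prop :=
  (∀ i, P.g i x ≤ 0) ∧ P.mulA x = P.b

/-- `x` is an optimal solution. -/
def IsSolution (P : Problem n mI mE) (x : E n) : Prop :=
  P.Feasible x ∧ IsMinOn P.f {y | P.Feasible y} x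

/-- The Karush–Kuhn–Tucker conditions at `(x, lam, ν)`. -/
structure IsKKT (P : Problem n mI mE) (x : E n) (lam : E mI) (ν : E mE) : Prop where
  feasible : P.Feasible x
  nonneg : ∀ i, 0 ≤ lam i
  complementary : ∀ i, lam i * P.g i x = 0
  stationary : gradient P.f x + ∑ i, lam i • gradient (P.g i) x + P.mulAT ν = 0

/-- Indices of the constraints that are active at `xs`. -/
abbrev Active (P : Problem n mI mE) (xs : E n) : Type := {i : Fin mI // P.g i xs = 0}

/-- The matrix `[J_I; A]`: the gradients at `xs` of the active inequality constraints,
stacked over the rows of `A`. -/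
def activeMatrix (P : Problem n mI mE) (xs : E n) :
    Matrix (P.Active xs ⊕ Fin mE) (Fin n) ℝ :=
  Matrix.of (Sum.elim (fun i k => gradient (P.g i.1) xs k) (fun j k => P.A j k))

/-- Linear independence constraint qualification at `xs`. -/
def LICQ (P : Problem n mI mE) (xs : E n) : Prop :=
  LinearIndependent ℝ (P.activeMatrix xs).row

/-- The smallest eigenvalue of `[J_I; A] [J_I; A]ᵀ` (the conjugate transpose of a real matrix is
its transpose). -/
def kappa (P : Problem n mI mE) (xs : E n) : ℝ :=
  ⨅ r, (Matrix.isHermitian_mul_conjTranspose_self (P.activeMatrix xs)).eigenvalues r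

/-- Indices of the constraints that are inactive at `xs`. -/
def inactive (P : Problem n mI mE) (xs : E n) : Finset (Fin mI) :=
  Finset.univ.filter fun i => P.g i xs ≠ 0

/-- `δ_min = 1 - [1 + ρ * max_{i inactive} g_i(xs) / d₀]₊ ^ 2`. When no constraint is inactive
(the maximum is `-∞`) or `d₀ = 0` (the limit `d₀ → 0⁺`), the value is `1`. -/
def deltaMin (P : Problem n mI mE) (xs : E n) (ρ d₀ : ℝ) : ℝ :=
  if h : (P.inactive xs).Nonempty ∧ 0 < d₀ then
    1 - (max (1 + ρ * (P.inactive xs).sup' h.1 (fun i => P.g i xs) / d₀) 0) ^ 2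
  else 1

/-- `(x, lam, ν)` is differentiable on `[0, ∞)` and solves the augmented primal-dual gradient
dynamics with parameter `ρ` there (with the one-sided derivative at `0`). -/
structure IsTrajectory (P : Problem n mI mE) (ρ : ℝ)
    (x : ℝ → E n) (lam : ℝ → E mI) (ν : ℝ → E mE) : Prop where
  deriv_x : ∀ t, 0 ≤ t → HasDerivWithinAt x
    (-gradient P.f (x t) - P.mulAT (ν t)
      - ∑ i, max (ρ * P.g i (x t) + lam t i) 0 • gradient (P.g i) (x t)) (Ici 0) t
  deriv_lam : ∀ t, 0 ≤ t → HasDerivWithinAt lam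
    (WithLp.toLp 2 fun i => (max (ρ * P.g i (x t) + lam t i) 0 - lam t i) / ρ) (Ici 0) t
  deriv_ν : ∀ t, 0 ≤ t → HasDerivWithinAt ν (P.mulA (x t) - P.b) (Ici 0) t

end Problem

/-- The Euclidean distance of `(x, lam, ν)` and `(xs, lams, νs)` in `ℝ^n × ℝ^mI × ℝ^mE`. -/
def zdist (x : E n) (lam : E mI) (ν : E mE) (xs : E n) (lams : E mI) (νs : E mE) : ℝ :=
  Real.sqrt (‖x - xs‖ ^ 2 + ‖lam - lams‖ ^ 2 + ‖ν - νs‖ ^ 2)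

/-- `√(∑ i, (v i)²)`, which aggregates `L_{g,i}` to `L_g` and `M_{g,i}` to `M_g`. -/
def aggregate (v : Fin mI → ℝ≥0) : ℝ := Real.sqrt (∑ i, (v i : ℝ) ^ 2)

/-- `M_Θ = ρ L_g² + (ρ L_g d₀ + d₀ + ‖λ*‖) M_g`. -/
def MTheta (ρ Lg Mg d₀ normLams : ℝ) : ℝ :=
  ρ * Lg ^ 2 + (ρ * Lg * d₀ + d₀ + normLams) * Mg

/-- The first condition on the rate: `β ≤ κ δ_min / (46 ρ (L_g² + ‖A‖²))`. -/
def RateCond₁ (β κ δ ρ Lg normA : ℝ) : Prop :=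
  β ≤ κ * δ / (46 * ρ * (Lg ^ 2 + normA ^ 2))

/-- The second condition on the rate:
`κ μ / (4 β) - 4 β² ≥ ‖A‖² + L_g² + κ / 4 + (ℓ + M_Θ) (μ + M_Θ + 1 / ρ) + 1 / (2 ρ²)`. -/
def RateCond₂ (β κ μ ℓ ρ Lg normA MΘ : ℝ) : Prop :=
  κ * μ / (4 * β) - 4 * β ^ 2 ≥
    normA ^ 2 + Lg ^ 2 + κ / 4 + (ℓ + MΘ) * (μ + MΘ + 1 / ρ) + 1 / (2 * ρ ^ 2)

end AugPDGD

end

/-! Write Θ = [ρ g(x) + λ]₊, let B be the active matrix at x*, and let y collect the errors of the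
active inequality multipliers and of ν. By convexity, ‖z - z*‖² has derivative at most -2⟨∇f(x) -
∇f(x*), x - x*⟩ - 2Q/ρ, where Q ≥ ‖Θ - λ‖² is the total `dissipation` (`IsKKT.pairing_le`). So the
trajectory stays in the ball of radius d₀, where the bounds L_g and M_g are valid.

This controls x by strong convexity, and the inactive multipliers through Q with loss δ_min
(`mul_sq_le_dissipation`), but not y. Since the velocity of x contains -Bᵀy, adding the cross term
2c⟨x - x*, Bᵀy⟩ to the squared distance produces -2c‖Bᵀy‖² ≤ -2cκ‖y‖². With c = 2β/κ, half of this
pays for 2β‖y‖², and the other half absorbs the mixed terms by Young's inequality. `lyapunov_decay`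
balances all terms and gives V' ≤ -2βV.

Finally V lies between (1 - s)‖z - z*‖² and (1 + s)‖z - z*‖², where s is proportional to β with a
constant intrinsic to the problem. Hence M_β = √((1 + s)/(1 - s)) → 1. The multipliers come from
projecting ∇f(x*) onto the kernel of B (`IsSolution.exists_isKKT`). -/

section Convex

/-! ### First-order inequalities for convex functions. -/

variable {F : Type*} [NormedAddCommGroup F] [InnerProductSpace ℝ F] [CompleteSpace F]

open scoped RealInnerProductSpace

theorem hasDerivAt_comp_line {f : F → ℝ} (hf : Differentiable ℝ f) (x d : F) (t : ℝ) :
    HasDerivAt (fun s : ℝ => f (x + s • d)) ⟪gradient f (x + t • d), d⟫ t := by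
  have h1 : HasDerivAt (fun s : ℝ => x + s • d) d t := by
    simpa using ((hasDerivAt_id t).smul_const d).const_add x
  have h2 := (hf (x + t • d)).hasFDerivAt.comp_hasDerivAt t h1
  rwa [← inner_gradient_left] at h2

/-- Divide strong convexity on the segment by t and let t → 0⁺: the difference quotient becomes the
directional derivative. -/
theorem StrongConvexOn.add_inner_gradient_le {f : F → ℝ} {m : ℝ} (h : StrongConvexOn univ m f)
    (hf : Differentiable ℝ f) (x y : F) :
    f x + ⟪gradient f x, y - x⟫ + m / 2 * ‖y - x‖ ^ 2 ≤ f y := by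
  obtain ⟨-, hu⟩ := h
  have h1 := hasDerivAt_comp_line hf x (y - x) 0
  have h2 := h1.hasDerivWithinAt (s := Ioi 0)
  rw [hasDerivWithinAt_iff_tendsto_slope' (by simp)] at h2
  simp only [zero_smul, add_zero] at h2
  have h3 : Tendsto (fun t : ℝ => f y - f x - (1 - t) * (m / 2 * ‖y - x‖ ^ 2)) (𝓝[>] 0)
      (𝓝 (f y - f x - (1 - 0) * (m / 2 * ‖y - x‖ ^ 2))) := by
    apply Tendsto.mono_left _ nhdsWithin_le_nhds
    apply Continuous.tendsto
    fun_prop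
  have h4 := le_of_tendsto_of_tendsto h2 h3 ?_
  · linarith
  · filter_upwards [Ioo_mem_nhdsGT (show (0 : ℝ) < 1 by norm_num)] with t ht
    have h5 := hu (mem_univ x) (mem_univ y) (a := 1 - t) (b := t) (by linarith [ht.2]) ht.1.le
      (by ring)
    have h6 : (1 - t) • x + t • y = x + t • (y - x) := by
      rw [sub_smul, smul_sub, one_smul]; abel
    rw [h6, norm_sub_rev x y] at h5
    simp only [smul_eq_mul] at h5
    rw [slope_def_field, sub_zero, div_le_iff₀ ht.1]
    simp only [zero_smul, add_zero]
    nlinarith [h5]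

theorem ConvexOn.add_inner_gradient_le {f : F → ℝ} (h : ConvexOn ℝ univ f)
    (hf : Differentiable ℝ f) (x y : F) : f x + ⟪gradient f x, y - x⟫ ≤ f y := by
  simpa using (strongConvexOn_zero.2 h).add_inner_gradient_le hf x y

theorem StrongConvexOn.mul_norm_sq_le_inner_gradient_sub {f : F → ℝ} {m : ℝ}
    (h : StrongConvexOn univ m f) (hf : Differentiable ℝ f) (x y : F) :
    m * ‖x - y‖ ^ 2 ≤ ⟪gradient f x - gradient f y, x - y⟫ := by
  have h1 := h.add_inner_gradient_le hf x y
  have h2 := h.add_inner_gradient_le hf y x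
  rw [← neg_sub x y, inner_neg_right, norm_neg] at h1
  rw [inner_sub_left]
  linarith

/-- The descent lemma for functions with Lipschitz gradient. -/
theorem LipschitzWith.le_add_inner_gradient {f : F → ℝ} {ℓ : ℝ≥0}
    (h : LipschitzWith ℓ (gradient f)) (hf : Differentiable ℝ f) (x d : F) :
    f (x + d) ≤ f x + ⟪gradient f x, d⟫ + ℓ / 2 * ‖d‖ ^ 2 := by
  -- The defect of the inequality along the segment; the Lipschitz bound makes its derivative
  -- nonpositive.
  let φ : ℝ → ℝ := fun t => f (x + t • d) - t * ⟪gradient f x, d⟫ - t ^ 2 * (ℓ / 2 * ‖d‖ ^ 2)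
  have hφ : ∀ t, HasDerivAt φ
      (⟪gradient f (x + t • d), d⟫ - ⟪gradient f x, d⟫ - 2 * t * (ℓ / 2 * ‖d‖ ^ 2)) t := by
    intro t
    have h2 := ((hasDerivAt_id t).pow 2).mul_const (ℓ / 2 * ‖d‖ ^ 2)
    have h3 := ((hasDerivAt_comp_line hf x d t).sub
      ((hasDerivAt_id t).mul_const ⟪gradient f x, d⟫)).sub h2
    exact h3.congr_deriv (by simp)
  have hanti : AntitoneOn φ (Icc 0 1) := by
    apply antitoneOn_of_deriv_nonpos (convex_Icc 0 1)
    · exact fun t _ => (hφ t).continuousAt.continuousWithinAt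
    · exact fun t _ => (hφ t).differentiableAt.differentiableWithinAt
    · intro t ht
      rw [interior_Icc] at ht
      rw [(hφ t).deriv, ← inner_sub_left]
      have h1 := real_inner_le_norm (gradient f (x + t • d) - gradient f x) d
      have h2 := h.norm_sub_le (x + t • d) x
      rw [add_sub_cancel_left, norm_smul, Real.norm_of_nonneg ht.1.le] at h2
      nlinarith [mul_le_mul_of_nonneg_right h2 (norm_nonneg d)]
  have h01 := hanti (left_mem_Icc.2 zero_le_one) (right_mem_Icc.2 zero_le_one) zero_le_one
  simp only [φ] at h01
  simp only [one_smul, zero_smul, add_zero] at h01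
  linarith

/-- Cocoercivity of the gradient (Baillon–Haddad). -/
theorem ConvexOn.norm_sq_gradient_sub_le {f : F → ℝ} (hc : ConvexOn ℝ univ f) {ℓ : ℝ≥0}
    (h : LipschitzWith ℓ (gradient f)) (hf : Differentiable ℝ f) (x y : F) :
    ‖gradient f x - gradient f y‖ ^ 2 ≤ ℓ * ⟪gradient f x - gradient f y, x - y⟫ := by
  -- The point y - τ(∇f(y) - ∇f(x)) is bounded below by the tangent at x and above by the descent
  -- lemma. The choice τ = 1/ℓ is optimal; adding the two orders of x and y gives cocoercivity.
  have key : ∀ (τ : ℝ) (x y : F), f x + ⟪gradient f x, y - x⟫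
      + (τ - ℓ * τ ^ 2 / 2) * ‖gradient f y - gradient f x‖ ^ 2 ≤ f y := by
    intro τ x y
    set G := gradient f y - gradient f x with hG
    have h1 := h.le_add_inner_gradient hf y (-(τ • G))
    have h2 := hc.add_inner_gradient_le hf x (y + -(τ • G))
    have h3 : y + -(τ • G) - x = (y - x) - τ • G := by abel
    rw [h3, inner_sub_right, inner_smul_right] at h2
    rw [inner_neg_right, inner_smul_right, norm_neg, norm_smul, mul_pow, Real.norm_eq_abs,
      sq_abs] at h1
    have h4 : ⟪gradient f y, G⟫ - ⟪gradient f x, G⟫ = ‖G‖ ^ 2 := by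
      rw [← inner_sub_left, ← hG, real_inner_self_eq_norm_sq]
    have h5 : τ * ⟪gradient f y, G⟫ - τ * ⟪gradient f x, G⟫ = τ * ‖G‖ ^ 2 := by
      rw [← h4]; ring
    linarith
  rcases eq_or_lt_of_le ℓ.2 with h0 | h0
  · have h1 := h.norm_sub_le x y
    have h0' : (ℓ : ℝ) = 0 := h0.symm
    rw [h0', zero_mul] at h1 ⊢
    have := norm_nonneg (gradient f x - gradient f y)
    nlinarith
  · have h0' : (0 : ℝ) < ℓ := h0
    have h1 := key (1 / ℓ) x y
    have h2 := key (1 / ℓ) y x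
    rw [← neg_sub x y, inner_neg_right, norm_sub_rev] at h1
    have h3 : (1 / ℓ - ℓ * (1 / (ℓ : ℝ)) ^ 2 / 2) * ‖gradient f x - gradient f y‖ ^ 2
        = ‖gradient f x - gradient f y‖ ^ 2 / (2 * ℓ) := by
      field_simp; ring
    rw [h3] at h1 h2
    have h4 : ‖gradient f x - gradient f y‖ ^ 2 / ℓ ≤ ⟪gradient f x - gradient f y, x - y⟫ := by
      rw [inner_sub_left]
      have : ‖gradient f x - gradient f y‖ ^ 2 / ℓ
        = ‖gradient f x - gradient f y‖ ^ 2 / (2 * ℓ)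
          + ‖gradient f x - gradient f y‖ ^ 2 / (2 * ℓ) := by field_simp; ring
      linarith
    rw [div_le_iff₀ h0'] at h4
    linarith

end Convex

/-! ### Rayleigh bound for the smallest eigenvalue. -/

section MatrixLemmas

theorem Matrix.IsHermitian.iInf_eigenvalues_mul_le {ι : Type*} [Fintype ι] [DecidableEq ι]
    {M : Matrix ι ι ℝ} (hM : M.IsHermitian) (y : ι → ℝ) :
    (⨅ r, hM.eigenvalues r) * (y ⬝ᵥ y) ≤ y ⬝ᵥ (M *ᵥ y) := by
  let e := hM.eigenvectorBasis
  let Y : EuclideanSpace ℝ ι := WithLp.toLp 2 y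
  let Z : EuclideanSpace ℝ ι := WithLp.toLp 2 (M *ᵥ y)
  have h1 := e.sum_inner_mul_inner Y Y
  have h2 := e.sum_inner_mul_inner Y Z
  have hZ : ∀ i, inner ℝ (e i) Z = hM.eigenvalues i * inner ℝ (e i) Y := by
    intro i
    have h3 := hM.mulVec_eigenvectorBasis i
    have hMt : Mᵀ = M := by simpa using hM.eq
    simp only [Y, Z, e, EuclideanSpace.inner_eq_star_dotProduct, star_trivial]
    rw [dotProduct_comm, Matrix.dotProduct_mulVec, ← Matrix.mulVec_transpose, hMt, h3,
      smul_dotProduct, dotProduct_comm, smul_eq_mul]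
  have hYY : inner ℝ Y Y = y ⬝ᵥ y := by
    simp only [Y, EuclideanSpace.inner_eq_star_dotProduct, star_trivial]
  have hYZ : inner ℝ Y Z = y ⬝ᵥ (M *ᵥ y) := by
    simp only [Y, Z, EuclideanSpace.inner_eq_star_dotProduct, star_trivial, dotProduct_comm]
  rw [← hYY, ← hYZ, ← h1, ← h2, Finset.mul_sum]
  refine Finset.sum_le_sum fun i _ => ?_
  rw [hZ, real_inner_comm Y (e i)]
  have h4 : (⨅ r, hM.eigenvalues r) ≤ hM.eigenvalues i :=
    ciInf_le (Set.finite_range _).bddBelow i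
  nlinarith [mul_le_mul_of_nonneg_right h4 (mul_self_nonneg (inner ℝ Y (e i)))]

end MatrixLemmas

/-! ### The active matrix B, its Gram matrix and κ. -/

namespace AugPDGD

variable {n mI mE : ℕ}

namespace Problem

open scoped RealInnerProductSpace

theorem norm_mulA_le (P : Problem n mI mE) (x : E n) : ‖P.mulA x‖ ≤ ‖P.A‖ * ‖x‖ :=
  Matrix.l2_opNorm_mulVec P.A x

theorem norm_mulAT_le (P : Problem n mI mE) (ν : E mE) : ‖P.mulAT ν‖ ≤ ‖P.A‖ * ‖ν‖ := by
  have h := Matrix.l2_opNorm_mulVec P.Aᴴ ν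
  rwa [Matrix.l2_opNorm_conjTranspose] at h

theorem inner_mulAT (P : Problem n mI mE) (x : E n) (ν : E mE) :
    ⟪x, P.mulAT ν⟫ = ⟪P.mulA x, ν⟫ := by
  simp only [mulA, mulAT, EuclideanSpace.inner_eq_star_dotProduct, star_trivial]
  rw [Matrix.mulVec_transpose, ← Matrix.dotProduct_mulVec]

/-- The matrix of equality constraints as a continuous linear map. -/
noncomputable def clmA (P : Problem n mI mE) : E n →L[ℝ] E mE :=
  LinearMap.toContinuousLinearMap (Matrix.toEuclideanLin P.A)

/-- The transpose of the matrix of equality constraints as a continuous linear map. -/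
noncomputable def clmAT (P : Problem n mI mE) : E mE →L[ℝ] E n :=
  LinearMap.toContinuousLinearMap (Matrix.toEuclideanLin P.Aᵀ)

theorem clmAT_apply (P : Problem n mI mE) (ν : E mE) : P.clmAT ν = P.mulAT ν := rfl

/-- Indices of the constraints that are active at `xs`. -/
noncomputable def activeSet (P : Problem n mI mE) (xs : E n) : Finset (Fin mI) :=
  Finset.univ.filter fun i => P.g i xs = 0

/-- `Bᵀ y`, where `B` is the active matrix at `xs` and `y` consists of the multipliers of the
active constraints. -/
noncomputable def activeComb (P : Problem n mI mE) (xs : E n) (lam : E mI) (ν : E mE) : E n :=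
  ∑ i ∈ P.activeSet xs, lam i • gradient (P.g i) xs + P.mulAT ν

/-- The squared norm of the multipliers of the active constraints. -/
noncomputable def activeSq (P : Problem n mI mE) (xs : E n) (lam : E mI) (ν : E mE) : ℝ :=
  ∑ i ∈ P.activeSet xs, lam i ^ 2 + ‖ν‖ ^ 2

/-- The multipliers of the active constraints as one vector. -/
noncomputable def activeVec (P : Problem n mI mE) (xs : E n) (lam : E mI) (ν : E mE) :
    P.Active xs ⊕ Fin mE → ℝ := Sum.elim (fun i => lam i.1) (fun j => ν j)

theorem mem_activeSet {P : Problem n mI mE} {xs : E n} {i : Fin mI} :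
    i ∈ P.activeSet xs ↔ P.g i xs = 0 := by simp [activeSet]

theorem sum_active (P : Problem n mI mE) (xs : E n) {V : Type*} [AddCommMonoid V]
    (φ : Fin mI → V) : ∑ i : P.Active xs, φ i.1 = ∑ i ∈ P.activeSet xs, φ i :=
  (Finset.sum_subtype _ (fun _ => mem_activeSet) φ).symm

theorem activeMatrix_transpose_mulVec (P : Problem n mI mE) (xs : E n) (lam : E mI) (ν : E mE) :
    (P.activeMatrix xs)ᵀ *ᵥ P.activeVec xs lam ν = (P.activeComb xs lam ν).ofLp := by
  ext k
  simp only [Matrix.mulVec, dotProduct, Fintype.sum_sum_type, activeMatrix, activeVec,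
    Matrix.transpose_apply, Matrix.of_apply, Sum.elim_inl, Sum.elim_inr, activeComb,
    PiLp.add_apply, mulAT, WithLp.ofLp_sum, Finset.sum_apply, WithLp.ofLp_smul, Pi.smul_apply,
    smul_eq_mul]
  rw [P.sum_active xs (fun i => gradient (P.g i) xs k * lam i)]
  simp [mul_comm]

theorem activeMatrix_mulVec_inl (P : Problem n mI mE) (xs : E n) (x : E n) (i : P.Active xs) :
    (P.activeMatrix xs *ᵥ x.ofLp) (Sum.inl i) = ⟪gradient (P.g i.1) xs, x⟫ := by
  simp only [Matrix.mulVec, dotProduct, activeMatrix, PiLp.inner_apply, Matrix.of_apply,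
    Sum.elim_inl, RCLike.inner_apply, conj_trivial, mul_comm]

theorem activeMatrix_mulVec_inr (P : Problem n mI mE) (xs : E n) (x : E n) (j : Fin mE) :
    (P.activeMatrix xs *ᵥ x.ofLp) (Sum.inr j) = P.mulA x j := by
  simp [Matrix.mulVec, dotProduct, activeMatrix, mulA]

theorem activeVec_dotProduct_self (P : Problem n mI mE) (xs : E n) (lam : E mI) (ν : E mE) :
    P.activeVec xs lam ν ⬝ᵥ P.activeVec xs lam ν = P.activeSq xs lam ν := by
  simp only [dotProduct, Fintype.sum_sum_type, activeVec, Sum.elim_inl, Sum.elim_inr, activeSq,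
    EuclideanSpace.real_norm_sq_eq]
  rw [P.sum_active xs (fun i => lam i * lam i)]
  simp [sq]

theorem dotProduct_gram_mulVec (P : Problem n mI mE) (xs : E n)
    (y : P.Active xs ⊕ Fin mE → ℝ) :
    y ⬝ᵥ ((P.activeMatrix xs * (P.activeMatrix xs)ᴴ) *ᵥ y) =
      ((P.activeMatrix xs)ᵀ *ᵥ y) ⬝ᵥ ((P.activeMatrix xs)ᵀ *ᵥ y) := by
  rw [Matrix.conjTranspose_eq_transpose_of_trivial, ← Matrix.mulVec_mulVec,
    Matrix.dotProduct_mulVec, ← Matrix.mulVec_transpose]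

theorem ofLp_dotProduct_self {p : ℕ} (x : E p) : x.ofLp ⬝ᵥ x.ofLp = ‖x‖ ^ 2 := by
  rw [EuclideanSpace.real_norm_sq_eq]
  simp [dotProduct, sq]

theorem kappa_mul_activeSq_le (P : Problem n mI mE) (xs : E n) (lam : E mI) (ν : E mE) :
    P.kappa xs * P.activeSq xs lam ν ≤ ‖P.activeComb xs lam ν‖ ^ 2 := by
  have h := (Matrix.isHermitian_mul_conjTranspose_self
    (P.activeMatrix xs)).iInf_eigenvalues_mul_le (P.activeVec xs lam ν)
  rwa [dotProduct_gram_mulVec, activeMatrix_transpose_mulVec, ofLp_dotProduct_self,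
    activeVec_dotProduct_self] at h

theorem LICQ.posDef_gram {P : Problem n mI mE} {xs : E n} (h : P.LICQ xs) :
    (P.activeMatrix xs * (P.activeMatrix xs)ᴴ).PosDef :=
  Matrix.PosDef.mul_conjTranspose_self _ (Matrix.vecMul_injective_iff.2 h)

/-- The infimum is attained at a positive eigenvalue because there is a row; without rows it would
be 0 by convention. -/
theorem LICQ.kappa_pos {P : Problem n mI mE} {xs : E n} (h : P.LICQ xs)
    (hrows : 0 < Fintype.card (P.Active xs) + mE) : 0 < P.kappa xs := by
  have hne : Nonempty (P.Active xs ⊕ Fin mE) := by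
    rw [← Fintype.card_pos_iff]; simpa using hrows
  obtain ⟨r, hr⟩ := exists_eq_ciInf_of_finite (f :=
    (Matrix.isHermitian_mul_conjTranspose_self (P.activeMatrix xs)).eigenvalues)
  rw [kappa, ← hr]
  exact h.posDef_gram.eigenvalues_pos r

theorem exists_activeVec_eq (P : Problem n mI mE) (xs : E n) (y : P.Active xs ⊕ Fin mE → ℝ) :
    ∃ (lam : E mI) (ν : E mE), (∀ i, P.g i xs ≠ 0 → lam i = 0) ∧ P.activeVec xs lam ν = y := by
  refine ⟨WithLp.toLp 2 fun i => if hi : P.g i xs = 0 then y (Sum.inl ⟨i, hi⟩) else 0,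
    WithLp.toLp 2 fun j => y (Sum.inr j), fun i hi => by simp [hi], ?_⟩
  ext (i | j)
  · simp [activeVec, i.2]
  · simp [activeVec]

/-- Under LICQ the active matrix is onto, with preimages in the range of its transpose. -/
theorem LICQ.exists_activeComb {P : Problem n mI mE} {xs : E n} (h : P.LICQ xs)
    (c : Fin mI → ℝ) (e : E mE) :
    ∃ (lam : E mI) (ν : E mE), (∀ i, P.g i xs ≠ 0 → lam i = 0) ∧
      (∀ i, P.g i xs = 0 → ⟪gradient (P.g i) xs, P.activeComb xs lam ν⟫ = c i) ∧
      P.mulA (P.activeComb xs lam ν) = e := by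
  -- LICQ makes the Gram matrix invertible, so Bᵀ(BBᵀ)⁻¹ is a right inverse of B.
  set G := P.activeMatrix xs * (P.activeMatrix xs)ᴴ with hG
  let y : P.Active xs ⊕ Fin mE → ℝ := Sum.elim (fun i => c i.1) (fun j => e j)
  obtain ⟨lam, ν, hlam, hy⟩ := P.exists_activeVec_eq xs (G⁻¹ *ᵥ y)
  have hdet : IsUnit G.det := (Matrix.isUnit_iff_isUnit_det _).1 h.posDef_gram.isUnit
  have key : P.activeMatrix xs *ᵥ (P.activeComb xs lam ν).ofLp = y := by
    rw [← activeMatrix_transpose_mulVec, hy, Matrix.mulVec_mulVec,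
      ← Matrix.conjTranspose_eq_transpose_of_trivial, ← hG, Matrix.mulVec_mulVec,
      Matrix.mul_nonsing_inv _ hdet, Matrix.one_mulVec]
  refine ⟨lam, ν, hlam, fun i hi => ?_, ?_⟩
  · rw [← P.activeMatrix_mulVec_inl xs _ ⟨i, hi⟩, key]; rfl
  · ext j
    rw [← P.activeMatrix_mulVec_inr xs, key]; rfl

theorem inner_activeComb (P : Problem n mI mE) (xs x : E n) (lam : E mI) (ν : E mE) :
    ⟪x, P.activeComb xs lam ν⟫ =
      ∑ i ∈ P.activeSet xs, lam i * ⟪x, gradient (P.g i) xs⟫ + ⟪P.mulA x, ν⟫ := by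
  rw [activeComb, inner_add_right, inner_sum, inner_mulAT]
  simp [inner_smul_right]

theorem norm_sum_smul_le {p : ℕ} {ι : Type*} (s : Finset ι) (a : ι → ℝ) (v : ι → E p) :
    ‖∑ i ∈ s, a i • v i‖ ≤ √(∑ i ∈ s, a i ^ 2) * √(∑ i ∈ s, ‖v i‖ ^ 2) := by
  calc ‖∑ i ∈ s, a i • v i‖ ≤ ∑ i ∈ s, ‖a i • v i‖ := norm_sum_le _ _
    _ = ∑ i ∈ s, |a i| * ‖v i‖ := by simp [norm_smul]
    _ ≤ √(∑ i ∈ s, |a i| ^ 2) * √(∑ i ∈ s, ‖v i‖ ^ 2) := Real.sum_mul_le_sqrt_mul_sqrt _ _ _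
    _ = _ := by simp

theorem norm_activeComb_sq_le (P : Problem n mI mE) (xs : E n) (lam : E mI) (ν : E mE) :
    ‖P.activeComb xs lam ν‖ ^ 2 ≤
      (∑ i ∈ P.activeSet xs, ‖gradient (P.g i) xs‖ ^ 2 + ‖P.A‖ ^ 2) * P.activeSq xs lam ν := by
  have h1 := norm_add_le (∑ i ∈ P.activeSet xs, lam i • gradient (P.g i) xs) (P.mulAT ν)
  have h2 := norm_sum_smul_le (P.activeSet xs) (fun i => lam i) fun i => gradient (P.g i) xs
  have h3 := P.norm_mulAT_le ν
  have hS1 : 0 ≤ ∑ i ∈ P.activeSet xs, lam i ^ 2 := Finset.sum_nonneg fun _ _ => sq_nonneg _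
  have hS2 : 0 ≤ ∑ i ∈ P.activeSet xs, ‖gradient (P.g i) xs‖ ^ 2 :=
    Finset.sum_nonneg fun _ _ => sq_nonneg _
  rw [activeComb, activeSq]
  rw [← Real.sq_sqrt hS1, ← Real.sq_sqrt hS2]
  set a := √(∑ i ∈ P.activeSet xs, lam i ^ 2)
  set b := √(∑ i ∈ P.activeSet xs, ‖gradient (P.g i) xs‖ ^ 2)
  have h4 : ‖∑ i ∈ P.activeSet xs, lam i • gradient (P.g i) xs + P.mulAT ν‖
      ≤ a * b + ‖P.A‖ * ‖ν‖ := by linarith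
  have h5 := pow_le_pow_left₀ (norm_nonneg _) h4 2
  -- Cauchy–Schwarz in the plane for (a, ‖ν‖) and (b, ‖A‖).
  nlinarith [sq_nonneg (a * ‖P.A‖ - b * ‖ν‖)]

theorem exists_activeSq_pos (P : Problem n mI mE) (xs : E n)
    (hrows : 0 < Fintype.card (P.Active xs) + mE) :
    ∃ (lam : E mI) (ν : E mE), 0 < P.activeSq xs lam ν := by
  have hne : Nonempty (P.Active xs ⊕ Fin mE) := by
    rw [← Fintype.card_pos_iff]; simpa using hrows
  obtain ⟨lam, ν, -, h⟩ := P.exists_activeVec_eq xs (fun _ => 1)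
  refine ⟨lam, ν, ?_⟩
  rw [← activeVec_dotProduct_self, h]
  have h2 : (0 : ℝ) < (Fintype.card (P.Active xs) + mE : ℕ) := Nat.cast_pos.2 hrows
  simpa [dotProduct] using h2

/-- One nonzero y tests the lower and upper bounds of ‖Bᵀy‖². This later turns the first rate
condition into a bound of β itself. -/
theorem kappa_le (P : Problem n mI mE) (xs : E n)
    (hrows : 0 < Fintype.card (P.Active xs) + mE) :
    P.kappa xs ≤ ∑ i ∈ P.activeSet xs, ‖gradient (P.g i) xs‖ ^ 2 + ‖P.A‖ ^ 2 := by
  obtain ⟨lam, ν, h⟩ := P.exists_activeSq_pos xs hrows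
  exact le_of_mul_le_mul_right
    ((P.kappa_mul_activeSq_le xs lam ν).trans (P.norm_activeComb_sq_le xs lam ν)) h

end Problem

end AugPDGD

/-! ### Existence and uniqueness of KKT multipliers under LICQ. -/

namespace AugPDGD

variable {n mI mE : ℕ}

namespace Problem

open scoped RealInnerProductSpace

theorem activeComb_eq_of_forall_zero {P : Problem n mI mE} {xs : E n} {lam : E mI} {ν : E mE}
    (h : ∀ i, P.g i xs ≠ 0 → lam i = 0) :
    P.activeComb xs lam ν = ∑ i, lam i • gradient (P.g i) xs + P.mulAT ν := by
  rw [activeComb]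
  congr 1
  refine Finset.sum_subset (Finset.subset_univ _) fun i _ hi => ?_
  rw [h i (fun h0 => hi (mem_activeSet.2 h0)), zero_smul]

theorem mulA_add (P : Problem n mI mE) (x y : E n) : P.mulA (x + y) = P.mulA x + P.mulA y :=
  map_add P.clmA x y

theorem mulA_sub (P : Problem n mI mE) (x y : E n) : P.mulA (x - y) = P.mulA x - P.mulA y :=
  map_sub P.clmA x y

theorem mulA_smul (P : Problem n mI mE) (c : ℝ) (x : E n) : P.mulA (c • x) = c • P.mulA x :=
  map_smul P.clmA c x

theorem mulAT_sub (P : Problem n mI mE) (x y : E mE) : P.mulAT (x - y) = P.mulAT x - P.mulAT y :=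
  map_sub P.clmAT x y

theorem activeComb_sub (P : Problem n mI mE) (xs : E n) (lam lam' : E mI) (ν ν' : E mE) :
    P.activeComb xs (lam - lam') (ν - ν') = P.activeComb xs lam ν - P.activeComb xs lam' ν' := by
  simp only [activeComb, mulAT_sub, PiLp.sub_apply, sub_smul, Finset.sum_sub_distrib]
  abel

theorem IsKKT.eq_zero {P : Problem n mI mE} {xs : E n} {lam : E mI} {ν : E mE}
    (h : P.IsKKT xs lam ν) (i : Fin mI) (hi : P.g i xs ≠ 0) : lam i = 0 :=
  (mul_eq_zero.1 (h.complementary i)).resolve_right hi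

/-- Inactive multipliers vanish by complementarity; the difference of the others lies in the kernel
of Bᵀ, which is trivial as κ > 0. -/
theorem LICQ.isKKT_unique {P : Problem n mI mE} {xs : E n} (h : P.LICQ xs)
    (hrows : 0 < Fintype.card (P.Active xs) + mE) {lam lam' : E mI} {ν ν' : E mE}
    (h1 : P.IsKKT xs lam ν) (h2 : P.IsKKT xs lam' ν') : lam = lam' ∧ ν = ν' := by
  have e1 : gradient P.f xs + P.activeComb xs lam ν = 0 := by
    rw [activeComb_eq_of_forall_zero h1.eq_zero, ← add_assoc]; exact h1.stationary
  have e2 : gradient P.f xs + P.activeComb xs lam' ν' = 0 := by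
    rw [activeComb_eq_of_forall_zero h2.eq_zero, ← add_assoc]; exact h2.stationary
  have e3 : P.activeComb xs (lam - lam') (ν - ν') = 0 := by
    rw [activeComb_sub, ← add_sub_add_left_eq_sub _ _ (gradient P.f xs), e1, e2, sub_zero]
  have h3 := P.kappa_mul_activeSq_le xs (lam - lam') (ν - ν')
  rw [e3, norm_zero, activeSq] at h3
  have hk := h.kappa_pos hrows
  have hs : 0 ≤ ∑ i ∈ P.activeSet xs, (lam - lam') i ^ 2 :=
    Finset.sum_nonneg fun _ _ => sq_nonneg _
  have h4 : ∑ i ∈ P.activeSet xs, (lam - lam') i ^ 2 + ‖ν - ν'‖ ^ 2 ≤ 0 := by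
    by_contra hc
    push Not at hc
    nlinarith [mul_pos hk hc]
  have h5 : ‖ν - ν'‖ = 0 := by
    have := sq_nonneg ‖ν - ν'‖
    exact pow_eq_zero_iff two_ne_zero |>.1 (by linarith)
  have h6 : ∑ i ∈ P.activeSet xs, (lam - lam') i ^ 2 = 0 := by
    have := sq_nonneg ‖ν - ν'‖
    linarith
  rw [Finset.sum_eq_zero_iff_of_nonneg fun _ _ => sq_nonneg _] at h6
  refine ⟨?_, sub_eq_zero.1 (norm_eq_zero.1 h5)⟩
  ext i
  by_cases hi : P.g i xs = 0
  · have := pow_eq_zero_iff two_ne_zero |>.1 (h6 i (mem_activeSet.2 hi))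
    rw [PiLp.sub_apply] at this
    linarith
  · rw [h1.eq_zero i hi, h2.eq_zero i hi]

/-- Strictly feasible directions are not descent directions at an optimal solution. -/
theorem IsSolution.inner_nonneg_of_strict {P : Problem n mI mE} {xs : E n} (hs : P.IsSolution xs)
    (hf : Differentiable ℝ P.f) (hg : ∀ i, Differentiable ℝ (P.g i)) {d : E n}
    (hA : P.mulA d = 0) (hd : ∀ i, P.g i xs = 0 → ⟪gradient (P.g i) xs, d⟫ < 0) :
    0 ≤ ⟪gradient P.f xs, d⟫ := by
  have hfeas : ∀ᶠ t : ℝ in 𝓝[>] 0, P.Feasible (xs + t • d) := by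
    have h1 : ∀ i, ∀ᶠ t : ℝ in 𝓝[>] 0, P.g i (xs + t • d) ≤ 0 := by
      intro i
      rcases (hs.1.1 i).lt_or_eq with hi | hi
      · have hc : ContinuousAt (fun t : ℝ => P.g i (xs + t • d)) 0 :=
          (hasDerivAt_comp_line (hg i) xs d 0).continuousAt
        have h2 : ∀ᶠ t : ℝ in 𝓝 0, P.g i (xs + t • d) < 0 :=
          hc.eventually_lt continuousAt_const (by simpa using hi)
        exact (h2.filter_mono nhdsWithin_le_nhds).mono fun t ht => ht.le
      · have h2 := (hasDerivAt_comp_line (hg i) xs d 0).hasDerivWithinAt (s := Ioi 0)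
        rw [hasDerivWithinAt_iff_tendsto_slope' (by simp)] at h2
        simp only [zero_smul, add_zero] at h2
        filter_upwards [h2.eventually_lt_const (hd i hi), self_mem_nhdsWithin] with t ht ht0
        rw [slope_def_field] at ht
        simp only [zero_smul, add_zero, hi, sub_zero] at ht
        exact (neg_of_div_neg_left ht (le_of_lt ht0)).le
    filter_upwards [eventually_all.2 h1] with t ht
    exact ⟨ht, by rw [mulA_add, mulA_smul, hA, smul_zero, add_zero, hs.1.2]⟩
  have h2 := (hasDerivAt_comp_line hf xs d 0).hasDerivWithinAt (s := Ioi 0)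
  rw [hasDerivWithinAt_iff_tendsto_slope' (by simp)] at h2
  simp only [zero_smul, add_zero] at h2
  refine ge_of_tendsto h2 ?_
  filter_upwards [hfeas, self_mem_nhdsWithin] with t ht ht0
  rw [slope_def_field]
  have h3 : P.f xs ≤ P.f (xs + t • d) := hs.2 ht
  simp only [zero_smul, add_zero, sub_zero]
  exact div_nonneg (by linarith) (le_of_lt ht0)

/-- Under LICQ, linearized feasible directions are not descent directions. -/
theorem IsSolution.inner_nonneg {P : Problem n mI mE} {xs : E n} (hs : P.IsSolution xs)
    (hf : Differentiable ℝ P.f) (hg : ∀ i, Differentiable ℝ (P.g i)) (hL : P.LICQ xs) {d : E n}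
    (hA : P.mulA d = 0) (hd : ∀ i, P.g i xs = 0 → ⟪gradient (P.g i) xs, d⟫ ≤ 0) :
    0 ≤ ⟪gradient P.f xs, d⟫ := by
  -- The direction r points strictly into all active constraints, so d + ε r is strictly feasible to
  -- first order; then ε → 0⁺.
  obtain ⟨lam, ν, -, h1, h2⟩ := hL.exists_activeComb (fun _ => -1) 0
  set r := P.activeComb xs lam ν
  have h3 : Tendsto (fun ε : ℝ => ⟪gradient P.f xs, d + ε • r⟫) (𝓝[>] 0)
      (𝓝 ⟪gradient P.f xs, d + (0 : ℝ) • r⟫) := by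
    apply Tendsto.mono_left _ nhdsWithin_le_nhds
    apply Continuous.tendsto
    fun_prop
  rw [zero_smul, add_zero] at h3
  refine ge_of_tendsto h3 ?_
  filter_upwards [self_mem_nhdsWithin] with ε hε
  refine hs.inner_nonneg_of_strict hf hg ?_ fun i hi => ?_
  · rw [mulA_add, mulA_smul, hA, h2, smul_zero, add_zero]
  · rw [inner_add_right, inner_smul_right, h1 i hi]
    have h4 := hd i hi
    have h5 : (0 : ℝ) < ε := hε
    linarith

/-- The Karush–Kuhn–Tucker theorem under LICQ. -/
theorem IsSolution.exists_isKKT {P : Problem n mI mE} {xs : E n} (hs : P.IsSolution xs)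
    (hf : Differentiable ℝ P.f) (hg : ∀ i, Differentiable ℝ (P.g i)) (hL : P.LICQ xs) :
    ∃ (lam : E mI) (ν : E mE), P.IsKKT xs lam ν := by
  -- The normal equations: r below is the projection of ∇f(x*) onto the kernel of B. As -r is a
  -- linearized feasible direction, -‖r‖² = ⟨∇f(x*), -r⟩ ≥ 0, so r = 0.
  obtain ⟨lam, ν, h0, h1, h2⟩ := hL.exists_activeComb
    (fun i => -⟪gradient (P.g i) xs, gradient P.f xs⟫) (-P.mulA (gradient P.f xs))
  set r := gradient P.f xs + P.activeComb xs lam ν with hr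
  have hrA : P.mulA r = 0 := by rw [hr, mulA_add, h2, add_neg_cancel]
  have hrg : ∀ i, P.g i xs = 0 → ⟪gradient (P.g i) xs, r⟫ = 0 := by
    intro i hi
    rw [hr, inner_add_right, h1 i hi, add_neg_cancel]
  have horth : ∀ d : E n, P.mulA d = 0 → ⟪d, P.activeComb xs lam ν⟫ =
      ∑ i ∈ P.activeSet xs, lam i * ⟪d, gradient (P.g i) xs⟫ := by
    intro d hd
    rw [inner_activeComb, hd, inner_zero_left, add_zero]
  have hr0 : r = 0 := by
    have h3 := hs.inner_nonneg hf hg hL (d := -r) (by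
      have := P.mulA_smul (-1) r
      rw [hrA, smul_zero, neg_one_smul] at this
      exact this) (fun i hi => by rw [inner_neg_right, hrg i hi, neg_zero])
    have h4 : ⟪r, P.activeComb xs lam ν⟫ = 0 := by
      rw [horth r hrA]
      refine Finset.sum_eq_zero fun i hi => ?_
      rw [real_inner_comm, hrg i (mem_activeSet.1 hi), mul_zero]
    have h5 : ⟪r, r⟫ = ⟪r, gradient P.f xs⟫ + ⟪r, P.activeComb xs lam ν⟫ := by
      rw [← inner_add_right]
    rw [h4, add_zero, real_inner_comm (gradient P.f xs) r] at h5
    rw [inner_neg_right] at h3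
    exact real_inner_self_nonpos.1 (by linarith)
  refine ⟨lam, ν, hs.1, fun i => ?_, fun i => ?_, ?_⟩
  · by_cases hi : P.g i xs = 0
    -- A direction d that leaves only the i-th active constraint to first order isolates the
    -- multiplier: λ_i = ⟨∇f(x*), d⟩ ≥ 0.
    · obtain ⟨lam', ν', -, h1', h2'⟩ := hL.exists_activeComb (fun j => if j = i then -1 else 0) 0
      set d := P.activeComb xs lam' ν'
      have h3 := hs.inner_nonneg hf hg hL h2' fun j hj => by
        rw [h1' j hj]; split_ifs <;> norm_num
      have h4 := horth d h2'
      have h5 : ⟪d, gradient P.f xs⟫ + ⟪d, P.activeComb xs lam ν⟫ = 0 := by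
        rw [← inner_add_right, ← hr, hr0, inner_zero_right]
      have h6 : ∑ j ∈ P.activeSet xs, lam j * ⟪d, gradient (P.g j) xs⟫ = -lam i := by
        rw [Finset.sum_eq_single_of_mem i (mem_activeSet.2 hi)]
        · rw [real_inner_comm, h1' i hi]; simp
        · intro j hj hji
          rw [real_inner_comm, h1' j (mem_activeSet.1 hj)]; simp [hji]
      rw [real_inner_comm] at h5
      linarith
    · rw [h0 i hi]
  · by_cases hi : P.g i xs = 0
    · rw [hi, mul_zero]
    · rw [h0 i hi, zero_mul]
  · rw [add_assoc, ← activeComb_eq_of_forall_zero h0, ← hr, hr0]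

end Problem

end AugPDGD

/-! ### Scalar inequalities: dissipation of one constraint and balance of the Lyapunov terms. -/

namespace AugPDGD

section Scalar

/-- The dissipation of one inequality constraint: with `Θ = [ρ g + lam]₊`, the pairing of the
increment of the augmented multiplier and of `lam` with the respective residuals. -/
def dissipation (ρ g gs lam lams : ℝ) : ℝ :=
  (max (ρ * g + lam) 0 - lams) * (ρ * (g - gs)) - (lam - lams) * (max (ρ * g + lam) 0 - lam)

variable {ρ g gs lam lams : ℝ}

/-- With u = ρ g + λ, the excess of the right side is exactly -λ* u if u ≤ 0 and -ρ g* u if u ≥ 0.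
-/
theorem sq_le_dissipation (hρ : 0 < ρ) (hgs : gs ≤ 0) (hlams : 0 ≤ lams) (hcomp : lams * gs = 0) :
    (max (ρ * g + lam) 0 - lam) ^ 2 ≤ dissipation ρ g gs lam lams := by
  rw [dissipation]
  have h1 : lams * (ρ * gs) = 0 := by rw [mul_left_comm, hcomp, mul_zero]
  have h2 : ρ * gs ≤ 0 := mul_nonpos_of_nonneg_of_nonpos hρ.le hgs
  rcases le_total (ρ * g + lam) 0 with h | h
  · rw [max_eq_right h]
    nlinarith [mul_nonneg hlams (neg_nonneg.2 h)]
  · rw [max_eq_left h]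
    nlinarith [mul_nonneg h (neg_nonneg.2 h2)]

/-- The case of an inactive constraint. For u = ρ g + λ ≥ 0 and r = -ρ g*/d₀, the dissipation is at
least r u λ + (u - λ)², since λ ≤ d₀. If r ≤ 1, completing the square gives at least (1 - (1 -
r)²)λ²/2; if r ≥ 1, already uλ + (u - λ)² ≥ 3λ²/4 suffices. -/
theorem mul_sq_le_dissipation {d₀ δ : ℝ} (hρ : 0 < ρ) (hgs : gs ≤ 0) (hlam : |lam| ≤ d₀)
    (hδ1 : δ ≤ 1) (hδ : 0 < d₀ → δ ≤ 1 - (max (1 + ρ * gs / d₀) 0) ^ 2) :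
    δ * lam ^ 2 ≤ 2 * dissipation ρ g gs lam 0 := by
  have hQ := sq_le_dissipation (g := g) (lam := lam) hρ hgs le_rfl (zero_mul gs)
  rcases le_total (ρ * g + lam) 0 with h | h
  · rw [max_eq_right h] at hQ
    nlinarith [sq_nonneg lam]
  rcases (le_trans (abs_nonneg _) hlam).eq_or_lt with h0 | h0
  · have : lam = 0 := by rw [← h0] at hlam; exact abs_nonpos_iff.1 hlam
    subst this
    nlinarith [sq_nonneg (max (ρ * g + 0) 0 - 0)]
  have hδ' := hδ h0
  have hDis : dissipation ρ g gs lam 0 =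
      (ρ * g + lam) * (-(ρ * gs)) + (ρ * g + lam - lam) ^ 2 := by
    rw [dissipation, max_eq_left h]; ring
  rw [hDis]
  set u := ρ * g + lam
  obtain ⟨r, hr⟩ : ∃ r, r = -(ρ * gs) / d₀ := ⟨_, rfl⟩
  have hm : -(ρ * gs) = r * d₀ := by rw [hr]; field_simp
  have hr0 : 0 ≤ r := by
    rw [hr]; exact div_nonneg (by nlinarith) h0.le
  have hr' : 1 + ρ * gs / d₀ = 1 - r := by rw [hr]; ring
  rw [hm]
  rw [hr'] at hδ'
  have hlam' : lam ≤ d₀ := (le_abs_self _).trans hlam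
  have h5 : r * (u * lam) ≤ u * (r * d₀) := by
    nlinarith [mul_le_mul_of_nonneg_left hlam' (mul_nonneg hr0 h)]
  rcases le_total 1 r with h1 | h1
  · have h6 : u * lam ≤ u * (r * d₀) := by
      have h7 : lam ≤ r * d₀ := by nlinarith
      exact mul_le_mul_of_nonneg_left h7 h
    nlinarith [sq_nonneg (u - lam), sq_nonneg u, sq_nonneg lam]
  · rw [max_eq_left (by linarith)] at hδ'
    have h8 : δ * lam ^ 2 ≤ (1 - (1 - r) ^ 2) * lam ^ 2 :=
      mul_le_mul_of_nonneg_right hδ' (sq_nonneg _)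
    nlinarith [sq_nonneg (u - lam + r * lam / 2), mul_nonneg (sq_nonneg r) (sq_nonneg lam)]

/-- The constant is 6 = 2·2 + 2·1, from Θ² ≤ 2λ² + 2(Θ - λ)² and the two preceding bounds. -/
theorem mul_sq_max_le_dissipation {d₀ δ : ℝ} (hρ : 0 < ρ) (hgs : gs ≤ 0) (hlam : |lam| ≤ d₀)
    (hδ0 : 0 ≤ δ) (hδ1 : δ ≤ 1) (hδ : 0 < d₀ → δ ≤ 1 - (max (1 + ρ * gs / d₀) 0) ^ 2) :
    δ * (max (ρ * g + lam) 0) ^ 2 ≤ 6 * dissipation ρ g gs lam 0 := by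
  have h1 := sq_le_dissipation (g := g) (lam := lam) hρ hgs le_rfl (zero_mul gs)
  have h2 := mul_sq_le_dissipation (g := g) hρ hgs hlam hδ1 hδ
  set Θ := max (ρ * g + lam) 0
  have h3 : Θ ^ 2 ≤ 2 * lam ^ 2 + 2 * (Θ - lam) ^ 2 := by nlinarith [sq_nonneg (Θ - 2 * lam)]
  have h4 := mul_le_mul_of_nonneg_left h3 hδ0
  have h5 : δ * (Θ - lam) ^ 2 ≤ (Θ - lam) ^ 2 := by
    nlinarith [mul_le_mul_of_nonneg_right hδ1 (sq_nonneg (Θ - lam))]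
  nlinarith

/-- Convexity turns the pairing of the dynamics with the error into the dissipation. -/
theorem pairing_le_neg_dissipation {p q : ℝ} (hρ : 0 < ρ) (hlams : 0 ≤ lams) (hp : g - gs ≤ p)
    (hq : q ≤ g - gs) :
    -(max (ρ * g + lam) 0 * p - lams * q) + (lam - lams) * ((max (ρ * g + lam) 0 - lam) / ρ) ≤
      -(dissipation ρ g gs lam lams / ρ) := by
  rw [dissipation]
  have h1 := mul_le_mul_of_nonneg_left hp (le_max_right (ρ * g + lam) 0)
  have h2 := mul_le_mul_of_nonneg_left hq hlams
  have h3 : ((max (ρ * g + lam) 0 - lams) * (ρ * (g - gs))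
      - (lam - lams) * (max (ρ * g + lam) 0 - lam)) / ρ
      = (max (ρ * g + lam) 0 - lams) * (g - gs)
        - (lam - lams) * ((max (ρ * g + lam) 0 - lam) / ρ) := by
    field_simp
  rw [h3]
  linarith

/-- The augmented multiplier depends in a nonexpansive way on its argument. -/
theorem abs_max_sub_le (hρ : 0 < ρ) (hgs : gs ≤ 0) (hlams : 0 ≤ lams) (hcomp : lams * gs = 0) :
    |max (ρ * g + lam) 0 - lams| ≤ ρ * |g - gs| + |lam - lams| := by
  -- Complementarity makes λ* a fixed point of the augmented multiplier map.
  have h1 : lams = max (ρ * gs + lams) 0 := by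
    rcases mul_eq_zero.1 hcomp with h | h
    · rw [h, max_eq_right]
      nlinarith
    · rw [h, mul_zero, zero_add, max_eq_left hlams]
  have h2 := abs_max_sub_max_le_abs (ρ * g + lam) (ρ * gs + lams) 0
  rw [← h1] at h2
  have h3 : ρ * g + lam - (ρ * gs + lams) = ρ * (g - gs) + (lam - lams) := by ring
  rw [h3] at h2
  refine h2.trans ((abs_add_le _ _).trans ?_)
  rw [abs_mul, abs_of_pos hρ]

/-- The form in which the second rate condition is used: scaling by c turns its leading term into
μ/2 and κ/4 into β/2. -/
theorem RateCond₂.mul_le {β κ μ ℓ ρ L a M c : ℝ} (h : RateCond₂ β κ μ ℓ ρ L a M) (hβ : 0 < β)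
    (hκ : 0 < κ) (hc : c = 2 * β / κ) :
    c * (4 * β ^ 2 + a ^ 2 + L ^ 2 + κ / 4 + (ℓ + M) * (μ + M + 1 / ρ) + 1 / (2 * ρ ^ 2)) ≤
      μ / 2 := by
  have hc0 : 0 < c := by rw [hc]; positivity
  have h1 : c * (κ * μ / (4 * β)) = μ / 2 := by rw [hc]; field_simp; ring
  rw [RateCond₂] at h
  rw [← h1]
  exact mul_le_mul_of_nonneg_left (by linarith) hc0.le

theorem mul_le_sq_div_eight_add (p y : ℝ) : p * y ≤ p ^ 2 / 8 + 2 * y ^ 2 := by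
  nlinarith [sq_nonneg (p - 4 * y)]

theorem mul_add_two_mul_le (p X M β : ℝ) : p * (M * X) + 2 * β * (X * p) ≤
    p ^ 2 / 4 + 2 * (M ^ 2 + 4 * β ^ 2) * X ^ 2 := by
  nlinarith [sq_nonneg (p - 2 * (M + 2 * β) * X), sq_nonneg ((M - 2 * β) * X)]

theorem mul_mul_le_sq_div_four_add (c w L X : ℝ) :
    c * (w * L * X) ≤ w ^ 2 / 4 + c * L ^ 2 * (c * X ^ 2) := by
  nlinarith [sq_nonneg (w / 2 - c * L * X)]

/-- The differential inequality for the Lyapunov function, in terms of the norms involved. -/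
theorem lyapunov_decay {β κ μ ℓ ρ L a M δ X p s F N Y Q w W z D c : ℝ}
    (hβ : 0 < β) (hκ : 0 < κ) (hμ : 0 < μ) (hℓ : 0 ≤ ℓ) (hρ : 0 < ρ) (hM : 0 ≤ M)
    (hκL : κ ≤ L ^ 2 + a ^ 2) (hc : c = 2 * β / κ)
    (hδ1 : δ ≤ 1) (h1 : RateCond₁ β κ δ ρ L a) (h2 : RateCond₂ β κ μ ℓ ρ L a (ρ * L ^ 2 + M))
    (hs : μ * X ^ 2 ≤ s) (hF : F ^ 2 ≤ ℓ * s) (hY : κ * Y ≤ p ^ 2) (hz : z ≤ X * p)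
    (hw : w ^ 2 ≤ Q) (hW : δ * W ^ 2 ≤ 6 * Q) (hN0 : 0 ≤ N) (hN : δ * N ≤ 2 * Q)
    (hD : D ≤ -2 * s - 2 / ρ * Q +
      2 * c * (-p ^ 2 + p * (F + M * X + L * W) + 1 / ρ * (w * L * X) + a ^ 2 * X ^ 2)) :
    D + 2 * β * (X ^ 2 + N + Y + 2 * c * z) ≤ 0 := by
  -- Dictionary: X = ‖x - x*‖, p = ‖Bᵀy‖, Y = ‖y‖², F = ‖∇f(x) - ∇f(x*)‖, s = its pairing with x -
  -- x*, N = squared inactive multipliers, Q = dissipation, w = ‖Θ - λ‖, W = norm of the residuals,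
  -- z = cross term, D = derivative of V, a = ‖A‖.
  have hc0 : 0 < c := by rw [hc]; positivity
  have hcκ : c * κ = 2 * β := by rw [hc]; field_simp
  have hLa : 0 < L ^ 2 + a ^ 2 := hκ.trans_le hκL
  rw [RateCond₁, le_div_iff₀ (by positivity)] at h1
  -- Since cκ = 2β, the constant 46 of the rate condition becomes 23.
  have hcL : c * (L ^ 2 + a ^ 2) * (23 * ρ) ≤ δ := by
    refine le_of_mul_le_mul_left ?_ hκ
    calc κ * (c * (L ^ 2 + a ^ 2) * (23 * ρ)) = (c * κ) * ((L ^ 2 + a ^ 2) * (23 * ρ)) := by ring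
      _ = β * (46 * ρ * (L ^ 2 + a ^ 2)) := by rw [hcκ]; ring
      _ ≤ κ * δ := h1
  have hδ0 : 0 ≤ δ := le_trans (by positivity) hcL
  have hβδ : 46 * ρ * β ≤ δ := by
    have : c * κ * (23 * ρ) ≤ c * (L ^ 2 + a ^ 2) * (23 * ρ) := by gcongr
    rw [hcκ] at this
    linarith
  have hcL' : c * L ^ 2 * (23 * ρ) ≤ δ := by
    have : c * L ^ 2 * (23 * ρ) ≤ c * (L ^ 2 + a ^ 2) * (23 * ρ) := by
      gcongr; linarith [sq_nonneg a]
    linarith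
  obtain ⟨q, hq⟩ : ∃ q, q = Q / ρ := ⟨_, rfl⟩
  have hQ : Q = q * ρ := by rw [hq]; field_simp
  have hq0 : 0 ≤ q := by rw [hq]; exact div_nonneg ((sq_nonneg w).trans hw) hρ.le
  -- Of the available 2q, the residuals use 24/23, the inactive multipliers 2/23 and the term with w
  -- another 1/2.
  have hWq : c * L ^ 2 * W ^ 2 ≤ 6 / 23 * q := by
    have h3 := mul_le_mul_of_nonneg_right hcL' (sq_nonneg W)
    rw [hQ] at hW
    refine le_of_mul_le_mul_right ?_ hρ
    linarith
  have hNq : β * N ≤ 1 / 23 * q := by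
    have h3 := mul_le_mul_of_nonneg_right hβδ hN0
    rw [hQ] at hN
    refine le_of_mul_le_mul_right ?_ hρ
    linarith
  obtain ⟨k, hk⟩ : ∃ k, k = 1 / ρ := ⟨_, rfl⟩
  have hk0 : 0 < k := by rw [hk]; positivity
  have hkρ : k * ρ = 1 := by rw [hk]; field_simp
  have h3 := h2.mul_le hβ hκ hc
  have hcLk : c * L ^ 2 ≤ k / 23 := by
    refine le_of_mul_le_mul_right ?_ hρ
    linarith
  have hwX : c * (k * (w * L * X)) ≤ q / 4 + k ^ 2 / 23 * (c * X ^ 2) := by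
    have h4 : c * (k * (w * L * X)) ≤ k * (w ^ 2 / 4 + (c * L ^ 2) * (c * X ^ 2)) := by
      have := mul_le_mul_of_nonneg_left (mul_mul_le_sq_div_four_add c w L X) hk0.le
      linarith
    have h5 : k * w ^ 2 ≤ q := by
      calc k * w ^ 2 ≤ k * Q := by gcongr
        _ = q * (k * ρ) := by rw [hQ]; ring
        _ = q := by rw [hkρ, mul_one]
    have h6 : (c * L ^ 2) * (c * X ^ 2) ≤ k / 23 * (c * X ^ 2) := by gcongr
    have h7 := mul_le_mul_of_nonneg_left h6 hk0.le
    linarith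
  -- The Young weights 1/8 + 1/4 + 1/8 make up 1/2, so these terms use c p² out of 2c p²; `hYp` uses
  -- the rest.
  have hpF : p * F ≤ p ^ 2 / 8 + 2 * (ℓ * s) := by
    linarith [mul_le_sq_div_eight_add p F]
  have hpX : p * (M * X) + 2 * β * (X * p) ≤
      p ^ 2 / 4 + 2 * (M ^ 2 + 4 * β ^ 2) * X ^ 2 := mul_add_two_mul_le p X M β
  have hpW : p * (L * W) ≤ p ^ 2 / 8 + 2 * (L ^ 2 * W ^ 2) := by
    linarith [mul_le_sq_div_eight_add p (L * W)]
  have hYp : 2 * β * Y ≤ c * p ^ 2 := by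
    have := mul_le_mul_of_nonneg_left hY hc0.le
    rw [← hcκ]; linarith
  have hzβ : 2 * β * z ≤ 2 * β * (X * p) := by gcongr
  have hrate : c * (4 * β ^ 2 + a ^ 2 + (ℓ * μ + M ^ 2) + k ^ 2 / 2) + β / 2 ≤ μ / 2 := by
    have h4 : ℓ * μ + M ^ 2 ≤ (ℓ + (ρ * L ^ 2 + M)) * (μ + (ρ * L ^ 2 + M) + 1 / ρ) := by
      rw [← hk]
      have h5 : 0 ≤ ρ * L ^ 2 := by positivity
      have : ℓ * μ + M * M ≤ (ℓ + (ρ * L ^ 2 + M)) * μ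
          + (ℓ + (ρ * L ^ 2 + M)) * (ρ * L ^ 2 + M) + (ℓ + (ρ * L ^ 2 + M)) * k := by
        have h6 : ℓ * μ ≤ (ℓ + (ρ * L ^ 2 + M)) * μ := by gcongr; linarith
        have h7 : M * M ≤ (ℓ + (ρ * L ^ 2 + M)) * (ρ * L ^ 2 + M) := by gcongr <;> linarith
        have h8 : 0 ≤ (ℓ + (ρ * L ^ 2 + M)) * k := by positivity
        linarith
      linarith
    have h5 : (1 : ℝ) / (2 * ρ ^ 2) = k ^ 2 / 2 := by rw [hk]; field_simp
    rw [h5] at h3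
    have h6 := mul_le_mul_of_nonneg_left h4 hc0.le
    have h7 : 0 ≤ c * L ^ 2 := by positivity
    linarith
  have hX2 : 0 ≤ X ^ 2 := sq_nonneg X
  have hcl : 2 * (c * ℓ) ≤ 1 := by
    have h4 : 0 ≤ c * (4 * β ^ 2 + a ^ 2 + M ^ 2 + k ^ 2 / 2) := by positivity
    refine le_of_mul_le_mul_right ?_ hμ
    linarith
  -- Cocoercivity has spent 4cℓ s of the available 2s; the remainder is still nonnegative and
  -- becomes a multiple of X².
  have hsX := mul_le_mul_of_nonneg_left hs (sub_nonneg.2 hcl)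
  have hrX := mul_le_mul_of_nonneg_right hrate hX2
  have hkX : 0 ≤ k ^ 2 * (c * X ^ 2) := by positivity
  have hβX : 0 ≤ c * (β ^ 2 * X ^ 2) := by positivity
  have haX : 0 ≤ c * (a ^ 2 * X ^ 2) := by positivity
  have hMX : 0 ≤ c * (M ^ 2 * X ^ 2) := by positivity
  have e1 := mul_le_mul_of_nonneg_left hpF hc0.le
  have e2 := mul_le_mul_of_nonneg_left hpX hc0.le
  have e3 := mul_le_mul_of_nonneg_left hpW hc0.le
  have e4 := mul_le_mul_of_nonneg_left hzβ hc0.le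
  have hQ2 : 2 / ρ * Q = 2 * q := by rw [hq]; ring
  rw [hQ2, ← hk] at hD
  linarith

end Scalar

end AugPDGD

/-! ### Estimates of the vector field at one point. -/

namespace AugPDGD

variable {n mI mE : ℕ}

theorem norm_euclidean_le {p : ℕ} {u v : E p} (h : ∀ i, |u i| ≤ |v i|) : ‖u‖ ≤ ‖v‖ := by
  rw [EuclideanSpace.norm_eq, EuclideanSpace.norm_eq]
  refine Real.sqrt_le_sqrt (Finset.sum_le_sum fun i _ => ?_)
  exact pow_le_pow_left₀ (norm_nonneg _) (h i) 2

theorem norm_toLp_coe_eq_aggregate (v : Fin mI → ℝ≥0) :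
    ‖(WithLp.toLp 2 fun i => (v i : ℝ) : E mI)‖ = aggregate v := by
  rw [EuclideanSpace.norm_eq, aggregate]
  simp

namespace Problem

open scoped RealInnerProductSpace

/-- The augmented multipliers `[ρ g(x) + lam]₊`. -/
noncomputable def augMult (P : Problem n mI mE) (ρ : ℝ) (x : E n) (lam : E mI) : E mI :=
  WithLp.toLp 2 fun i => max (ρ * P.g i x + lam i) 0

/-- The velocity of the primal variable. -/
noncomputable def velX (P : Problem n mI mE) (ρ : ℝ) (x : E n) (lam : E mI) (ν : E mE) : E n :=
  -gradient P.f x - P.mulAT ν - ∑ i, max (ρ * P.g i x + lam i) 0 • gradient (P.g i) x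

/-- The velocity of the multipliers of the inequality constraints. -/
noncomputable def velLam (P : Problem n mI mE) (ρ : ℝ) (x : E n) (lam : E mI) : E mI :=
  WithLp.toLp 2 fun i => (max (ρ * P.g i x + lam i) 0 - lam i) / ρ

/-- The sum of the dissipations of the inequality constraints. -/
noncomputable def totalDissipation (P : Problem n mI mE) (ρ : ℝ) (x xs : E n)
    (lam lams : E mI) : ℝ :=
  ∑ i, dissipation ρ (P.g i x) (P.g i xs) (lam i) (lams i)

/-- Coefficients of the gradients at `xs` in the deviation of the primal velocity: the residual of
the multiplier for active constraints, the augmented multiplier for inactive ones. -/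
noncomputable def residual (P : Problem n mI mE) (ρ : ℝ) (x xs : E n) (lam : E mI) (i : Fin mI) :
    ℝ :=
  if P.g i xs = 0 then P.augMult ρ x lam i - lam i else P.augMult ρ x lam i

variable {P : Problem n mI mE} {xs : E n} {lams : E mI} {νs : E mE}

theorem IsKKT.velX_eq (hK : P.IsKKT xs lams νs) (ρ : ℝ) (x : E n) (lam : E mI) (ν : E mE) :
    P.velX ρ x lam ν = -(gradient P.f x - gradient P.f xs) - P.mulAT (ν - νs)
      - ∑ i, (max (ρ * P.g i x + lam i) 0 • gradient (P.g i) x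
        - lams i • gradient (P.g i) xs) := by
  have h := hK.stationary
  rw [velX, mulAT_sub, Finset.sum_sub_distrib]
  have h2 : gradient P.f xs = -∑ i, lams i • gradient (P.g i) xs - P.mulAT νs := by
    rw [eq_sub_iff_add_eq, eq_neg_iff_add_eq_zero, ← h]; abel
  rw [h2]
  abel

/-- Isolates the damping term -Bᵀy; the remaining sums are errors from moving the gradients to x*
and from replacing λ by Θ. -/
theorem IsKKT.velX_eq_activeComb (hK : P.IsKKT xs lams νs) (ρ : ℝ) (x : E n) (lam : E mI)
    (ν : E mE) :
    P.velX ρ x lam ν = -(gradient P.f x - gradient P.f xs)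
      - P.activeComb xs (lam - lams) (ν - νs)
      - ∑ i, P.augMult ρ x lam i • (gradient (P.g i) x - gradient (P.g i) xs)
      - ∑ i, P.residual ρ x xs lam i • gradient (P.g i) xs := by
  rw [hK.velX_eq, activeComb]
  have h1 : ∑ i ∈ P.activeSet xs, (lam - lams) i • gradient (P.g i) xs =
      ∑ i, (if P.g i xs = 0 then (lam - lams) i else 0) • gradient (P.g i) xs := by
    rw [activeSet, Finset.sum_filter]
    refine Finset.sum_congr rfl fun i _ => ?_
    split_ifs <;> simp
  have h2 : ∑ i, (max (ρ * P.g i x + lam i) 0 • gradient (P.g i) x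
        - lams i • gradient (P.g i) xs) =
      ∑ i, (if P.g i xs = 0 then (lam - lams) i else 0) • gradient (P.g i) xs
      + ∑ i, P.augMult ρ x lam i • (gradient (P.g i) x - gradient (P.g i) xs)
      + ∑ i, P.residual ρ x xs lam i • gradient (P.g i) xs := by
    rw [← Finset.sum_add_distrib, ← Finset.sum_add_distrib]
    refine Finset.sum_congr rfl fun i _ => ?_
    simp only [residual, augMult, PiLp.sub_apply]
    split_ifs with hi
    · module
    · rw [hK.eq_zero i hi]; module
  rw [h1, h2]
  abel

theorem IsKKT.pairing_le (hK : P.IsKKT xs lams νs) (hg : ∀ i, Differentiable ℝ (P.g i))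
    (hgc : ∀ i, ConvexOn ℝ univ (P.g i)) {ρ : ℝ} (hρ : 0 < ρ) (x : E n) (lam : E mI) (ν : E mE) :
    ⟪x - xs, P.velX ρ x lam ν⟫ + ⟪lam - lams, P.velLam ρ x lam⟫ + ⟪ν - νs, P.mulA x - P.b⟫ ≤
      -⟪gradient P.f x - gradient P.f xs, x - xs⟫ - P.totalDissipation ρ x xs lam lams / ρ := by
  have h1 : P.mulA x - P.b = P.mulA (x - xs) := by rw [mulA_sub, hK.feasible.2]
  have h2 : ⟪lam - lams, P.velLam ρ x lam⟫ =
      ∑ i, (lam i - lams i) * ((max (ρ * P.g i x + lam i) 0 - lam i) / ρ) := by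
    simp [PiLp.inner_apply, velLam, mul_comm]
  rw [hK.velX_eq, h1, h2, inner_sub_right, inner_sub_right, inner_neg_right, inner_mulAT,
    inner_sum, real_inner_comm (P.mulA (x - xs)) (ν - νs),
    real_inner_comm (gradient P.f x - gradient P.f xs), totalDissipation, Finset.sum_div]
  have h3 : ∀ i, -(⟪x - xs, max (ρ * P.g i x + lam i) 0 • gradient (P.g i) x
      - lams i • gradient (P.g i) xs⟫)
      + (lam i - lams i) * ((max (ρ * P.g i x + lam i) 0 - lam i) / ρ)
      ≤ -(dissipation ρ (P.g i x) (P.g i xs) (lam i) (lams i) / ρ) := by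
    intro i
    have h4 := (hgc i).add_inner_gradient_le (hg i) x xs
    have h5 := (hgc i).add_inner_gradient_le (hg i) xs x
    rw [← neg_sub x xs, inner_neg_right] at h4
    rw [inner_sub_right, inner_smul_right, inner_smul_right, real_inner_comm,
      real_inner_comm (gradient (P.g i) xs)]
    exact pairing_le_neg_dissipation hρ (hK.nonneg i) (by linarith) (by linarith)
  have h6 := Finset.sum_le_sum fun i (_ : i ∈ Finset.univ) => h3 i
  rw [Finset.sum_add_distrib, Finset.sum_neg_distrib, Finset.sum_neg_distrib] at h6
  linarith

/-- By convexity, gradient bounds at the two endpoints suffice. -/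
theorem abs_sub_le_of_gradient_le {g : E n → ℝ} (hg : Differentiable ℝ g)
    (hc : ConvexOn ℝ univ g) {x y : E n} {L : ℝ} (hx : ‖gradient g x‖ ≤ L)
    (hy : ‖gradient g y‖ ≤ L) : |g x - g y| ≤ L * ‖x - y‖ := by
  have h1 := hc.add_inner_gradient_le hg x y
  have h2 := hc.add_inner_gradient_le hg y x
  have h3 := real_inner_le_norm (gradient g x) (x - y)
  have h4 := (abs_le.1 (abs_real_inner_le_norm (gradient g y) (x - y))).1
  have h5 := mul_le_mul_of_nonneg_right hx (norm_nonneg (x - y))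
  have h6 := mul_le_mul_of_nonneg_right hy (norm_nonneg (x - y))
  rw [← neg_sub x y, inner_neg_right] at h1
  rw [abs_le]
  constructor <;> linarith

/-- Minkowski's inequality applied to the componentwise bound `abs_max_sub_le`; this is the factor
of M_g in M_Θ. -/
theorem IsKKT.norm_augMult_le (hK : P.IsKKT xs lams νs) {ρ d₀ : ℝ} (hρ : 0 < ρ) {x : E n}
    {lam : E mI} {Lgi : Fin mI → ℝ≥0} (hx : ‖x - xs‖ ≤ d₀) (hlam : ‖lam - lams‖ ≤ d₀)
    (hL : ∀ i, |P.g i x - P.g i xs| ≤ Lgi i * ‖x - xs‖) :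
    ‖P.augMult ρ x lam‖ ≤ ρ * aggregate Lgi * d₀ + d₀ + ‖lams‖ := by
  let u : E mI := (ρ * ‖x - xs‖) • (WithLp.toLp 2 fun i => (Lgi i : ℝ))
  let v : E mI := WithLp.toLp 2 fun i => |(lam - lams) i|
  have h1 : ‖P.augMult ρ x lam - lams‖ ≤ ‖u + v‖ := by
    refine norm_euclidean_le fun i => ?_
    have h2 : (u + v) i = ρ * ‖x - xs‖ * Lgi i + |lam i - lams i| := by simp [u, v]
    have h5 : 0 ≤ ρ * ‖x - xs‖ * Lgi i + |lam i - lams i| := by positivity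
    rw [h2, abs_of_nonneg h5]
    have h3 := abs_max_sub_le (g := P.g i x) (lam := lam i) hρ (hK.feasible.1 i) (hK.nonneg i)
      (hK.complementary i)
    have h4 := mul_le_mul_of_nonneg_left (hL i) hρ.le
    simp only [PiLp.sub_apply, augMult]
    linarith
  have hu : ‖u‖ ≤ ρ * aggregate Lgi * d₀ := by
    rw [norm_smul, norm_toLp_coe_eq_aggregate, Real.norm_of_nonneg (by positivity)]
    have := Real.sqrt_nonneg (∑ i, (Lgi i : ℝ) ^ 2)
    have h0 : 0 ≤ aggregate Lgi := this
    calc ρ * ‖x - xs‖ * aggregate Lgi ≤ ρ * d₀ * aggregate Lgi := by gcongr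
      _ = _ := by ring
  have hv : ‖v‖ ≤ ‖lam - lams‖ := norm_euclidean_le fun i => by simp [v]
  calc ‖P.augMult ρ x lam‖ = ‖(P.augMult ρ x lam - lams) + lams‖ := by rw [sub_add_cancel]
    _ ≤ ‖P.augMult ρ x lam - lams‖ + ‖lams‖ := norm_add_le _ _
    _ ≤ _ := by linarith [norm_add_le u v]

theorem sqrt_sum_norm_sq_le_aggregate {v : Fin mI → E n} {a : ℝ} (ha : 0 ≤ a) {b : Fin mI → ℝ≥0}
    (h : ∀ i, ‖v i‖ ≤ b i * a) : √(∑ i, ‖v i‖ ^ 2) ≤ aggregate b * a := by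
  rw [aggregate, ← Real.sqrt_sq ha, ← Real.sqrt_mul (Finset.sum_nonneg fun _ _ => sq_nonneg _),
    Finset.sum_mul]
  refine Real.sqrt_le_sqrt (Finset.sum_le_sum fun i _ => ?_)
  rw [← mul_pow]
  exact pow_le_pow_left₀ (norm_nonneg _) (h i) 2

theorem IsKKT.inner_velX_activeComb_le (hK : P.IsKKT xs lams νs) {ρ d₀ : ℝ} (hρ : 0 < ρ) {x : E n}
    {lam : E mI} (ν : E mE) {Lgi Mgi : Fin mI → ℝ≥0} (hx : ‖x - xs‖ ≤ d₀)
    (hlam : ‖lam - lams‖ ≤ d₀) (hL : ∀ i, |P.g i x - P.g i xs| ≤ Lgi i * ‖x - xs‖)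
    (hLs : ∀ i, ‖gradient (P.g i) xs‖ ≤ Lgi i)
    (hM : ∀ i, ‖gradient (P.g i) x - gradient (P.g i) xs‖ ≤ Mgi i * ‖x - xs‖) :
    ⟪P.velX ρ x lam ν, P.activeComb xs (lam - lams) (ν - νs)⟫ ≤
      -‖P.activeComb xs (lam - lams) (ν - νs)‖ ^ 2 + ‖P.activeComb xs (lam - lams) (ν - νs)‖ *
        (‖gradient P.f x - gradient P.f xs‖
          + (ρ * aggregate Lgi * d₀ + d₀ + ‖lams‖) * aggregate Mgi * ‖x - xs‖
          + aggregate Lgi * √(∑ i, P.residual ρ x xs lam i ^ 2)) := by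
  rw [hK.velX_eq_activeComb]
  set T := P.activeComb xs (lam - lams) (ν - νs)
  set R := ∑ i, P.augMult ρ x lam i • (gradient (P.g i) x - gradient (P.g i) xs) with hR
  set S := ∑ i, P.residual ρ x xs lam i • gradient (P.g i) xs with hS
  have hd : 0 ≤ d₀ := (norm_nonneg _).trans hx
  have h0 : 0 ≤ aggregate Lgi := Real.sqrt_nonneg _
  have h0' : 0 ≤ aggregate Mgi := Real.sqrt_nonneg _
  have hRn : ‖R‖ ≤ (ρ * aggregate Lgi * d₀ + d₀ + ‖lams‖) * aggregate Mgi * ‖x - xs‖ := by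
    have h1 := norm_sum_smul_le Finset.univ (fun i => P.augMult ρ x lam i)
      (fun i => gradient (P.g i) x - gradient (P.g i) xs)
    have h2 := hK.norm_augMult_le hρ hx hlam hL
    have h3 := sqrt_sum_norm_sq_le_aggregate (norm_nonneg (x - xs)) hM
    have h4 : √(∑ i, P.augMult ρ x lam i ^ 2) = ‖P.augMult ρ x lam‖ := by
      rw [EuclideanSpace.norm_eq]; simp
    rw [h4] at h1
    calc ‖R‖ ≤ _ := h1
      _ ≤ (ρ * aggregate Lgi * d₀ + d₀ + ‖lams‖) * (aggregate Mgi * ‖x - xs‖) := by gcongr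
      _ = _ := by ring
  have hSn : ‖S‖ ≤ aggregate Lgi * √(∑ i, P.residual ρ x xs lam i ^ 2) := by
    have h1 := norm_sum_smul_le Finset.univ (fun i => P.residual ρ x xs lam i)
      (fun i => gradient (P.g i) xs)
    have h3 := sqrt_sum_norm_sq_le_aggregate zero_le_one (v := fun i => gradient (P.g i) xs)
      (b := Lgi) (fun i => by simpa using hLs i)
    rw [mul_one] at h3
    calc ‖S‖ ≤ _ := h1
      _ ≤ √(∑ i, P.residual ρ x xs lam i ^ 2) * aggregate Lgi := by gcongr
      _ = _ := by ring
  have hT := norm_nonneg T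
  have e1 := (abs_le.1 (abs_real_inner_le_norm (gradient P.f x - gradient P.f xs) T)).1
  have e2 := (abs_le.1 (abs_real_inner_le_norm R T)).1
  have e3 := (abs_le.1 (abs_real_inner_le_norm S T)).1
  have e4 := mul_le_mul_of_nonneg_right hRn hT
  have e5 := mul_le_mul_of_nonneg_right hSn hT
  rw [inner_sub_left, inner_sub_left, inner_sub_left, inner_neg_left, real_inner_self_eq_norm_sq]
  linarith

/-- The part of the cross derivative from moving multipliers. It contains ‖A(x - x*)‖² with the
unfavourable sign, which strong convexity must absorb. -/
theorem IsKKT.inner_activeComb_velLam_le (hK : P.IsKKT xs lams νs) {ρ : ℝ} (hρ : 0 < ρ) (x : E n)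
    (lam : E mI) {Lgi : Fin mI → ℝ≥0} (hLs : ∀ i, ‖gradient (P.g i) xs‖ ≤ Lgi i) :
    ⟪x - xs, P.activeComb xs (P.velLam ρ x lam) (P.mulA x - P.b)⟫ ≤
      1 / ρ * (‖P.augMult ρ x lam - lam‖ * aggregate Lgi * ‖x - xs‖)
        + ‖P.A‖ ^ 2 * ‖x - xs‖ ^ 2 := by
  have h1 : P.mulA x - P.b = P.mulA (x - xs) := by rw [mulA_sub, hK.feasible.2]
  rw [activeComb, inner_add_right, inner_mulAT, h1, real_inner_self_eq_norm_sq]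
  have h2 : ‖P.mulA (x - xs)‖ ^ 2 ≤ ‖P.A‖ ^ 2 * ‖x - xs‖ ^ 2 := by
    rw [← mul_pow]
    exact pow_le_pow_left₀ (norm_nonneg _) (P.norm_mulA_le _) 2
  have h3 := norm_sum_smul_le (P.activeSet xs) (fun i => P.velLam ρ x lam i)
      (fun i => gradient (P.g i) xs)
  have h4 : √(∑ i ∈ P.activeSet xs, P.velLam ρ x lam i ^ 2) ≤
      1 / ρ * ‖P.augMult ρ x lam - lam‖ := by
    have h5 : P.velLam ρ x lam = (1 / ρ) • (P.augMult ρ x lam - lam) := by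
      ext i; simp [velLam, augMult]; ring
    have h6 : ‖P.velLam ρ x lam‖ = 1 / ρ * ‖P.augMult ρ x lam - lam‖ := by
      rw [h5, norm_smul, Real.norm_of_nonneg (by positivity)]
    rw [← h6, EuclideanSpace.norm_eq]
    refine Real.sqrt_le_sqrt ?_
    simp only [Real.norm_eq_abs, sq_abs]
    exact Finset.sum_le_sum_of_subset_of_nonneg (Finset.subset_univ _) fun _ _ _ => sq_nonneg _
  have h7 : √(∑ i ∈ P.activeSet xs, ‖gradient (P.g i) xs‖ ^ 2) ≤ aggregate Lgi := by
    have h8 := sqrt_sum_norm_sq_le_aggregate zero_le_one (v := fun i => gradient (P.g i) xs)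
      (b := Lgi) (fun i => by simpa using hLs i)
    rw [mul_one] at h8
    refine le_trans (Real.sqrt_le_sqrt ?_) h8
    exact Finset.sum_le_sum_of_subset_of_nonneg (Finset.subset_univ _) fun _ _ _ => sq_nonneg _
  have h9 := real_inner_le_norm (x - xs)
    (∑ i ∈ P.activeSet xs, P.velLam ρ x lam i • gradient (P.g i) xs)
  have h10 : ‖∑ i ∈ P.activeSet xs, P.velLam ρ x lam i • gradient (P.g i) xs‖ ≤
      1 / ρ * ‖P.augMult ρ x lam - lam‖ * aggregate Lgi :=
    h3.trans (mul_le_mul h4 h7 (Real.sqrt_nonneg _) (by positivity))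
  have h11 := mul_le_mul_of_nonneg_left h10 (norm_nonneg (x - xs))
  linarith

theorem deltaMin_le_one (P : Problem n mI mE) (xs : E n) (ρ d₀ : ℝ) :
    P.deltaMin xs ρ d₀ ≤ 1 := by
  rw [deltaMin]
  split_ifs
  · linarith [sq_nonneg (max (1 + ρ * (P.inactive xs).sup' (by tauto) (fun i => P.g i xs) / d₀) 0)]
  · exact le_rfl

/-- The supremum selects the inactive constraint nearest to activity, the worst case. -/
theorem deltaMin_le (P : Problem n mI mE) {xs : E n} {ρ d₀ : ℝ} (hρ : 0 < ρ) (hd : 0 < d₀)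
    {i : Fin mI} (hi : P.g i xs ≠ 0) :
    P.deltaMin xs ρ d₀ ≤ 1 - (max (1 + ρ * P.g i xs / d₀) 0) ^ 2 := by
  have hmem : i ∈ P.inactive xs := by simp [inactive, hi]
  have h : (P.inactive xs).Nonempty ∧ 0 < d₀ := ⟨⟨i, hmem⟩, hd⟩
  rw [deltaMin, dif_pos h]
  have h1 := Finset.le_sup' (fun i => P.g i xs) hmem
  gcongr

theorem IsKKT.sq_norm_augMult_sub_le (hK : P.IsKKT xs lams νs) {ρ : ℝ} (hρ : 0 < ρ) (x : E n)
    (lam : E mI) :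
    ‖P.augMult ρ x lam - lam‖ ^ 2 ≤ P.totalDissipation ρ x xs lam lams := by
  rw [EuclideanSpace.real_norm_sq_eq, totalDissipation]
  exact Finset.sum_le_sum fun i _ => sq_le_dissipation hρ (hK.feasible.1 i) (hK.nonneg i)
    (hK.complementary i)

theorem abs_apply_le_norm {p : ℕ} (u : E p) (i : Fin p) : |u i| ≤ ‖u‖ :=
  PiLp.norm_apply_le u i

theorem IsKKT.deltaMin_mul_residual_le (hK : P.IsKKT xs lams νs) {ρ d₀ : ℝ} (hρ : 0 < ρ) (x : E n)
    {lam : E mI} (hlam : ‖lam - lams‖ ≤ d₀) (hδ : 0 ≤ P.deltaMin xs ρ d₀) :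
    P.deltaMin xs ρ d₀ * √(∑ i, P.residual ρ x xs lam i ^ 2) ^ 2 ≤
      6 * P.totalDissipation ρ x xs lam lams := by
  rw [Real.sq_sqrt (Finset.sum_nonneg fun _ _ => sq_nonneg _), totalDissipation, Finset.mul_sum,
    Finset.mul_sum]
  refine Finset.sum_le_sum fun i _ => ?_
  have hδ1 := P.deltaMin_le_one xs ρ d₀
  rw [residual]
  split_ifs with hi
  · have h1 := sq_le_dissipation (g := P.g i x) (lam := lam i) hρ (hK.feasible.1 i) (hK.nonneg i)
      (hK.complementary i)
    simp only [augMult]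
    have h2 := mul_le_mul_of_nonneg_right hδ1 (sq_nonneg (max (ρ * P.g i x + lam i) 0 - lam i))
    linarith [sq_nonneg (max (ρ * P.g i x + lam i) 0 - lam i)]
  · have h0 := hK.eq_zero i hi
    have h1 := (abs_apply_le_norm (lam - lams) i).trans hlam
    rw [PiLp.sub_apply, h0, sub_zero] at h1
    rw [h0]
    exact mul_sq_max_le_dissipation hρ (hK.feasible.1 i) h1 hδ hδ1
      fun hd => P.deltaMin_le hρ hd hi

theorem IsKKT.deltaMin_mul_inactive_le (hK : P.IsKKT xs lams νs) {ρ d₀ : ℝ} (hρ : 0 < ρ) (x : E n)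
    {lam : E mI} (hlam : ‖lam - lams‖ ≤ d₀) :
    P.deltaMin xs ρ d₀ * ∑ i ∈ P.inactive xs, (lam - lams) i ^ 2 ≤
      2 * P.totalDissipation ρ x xs lam lams := by
  have hnn : ∀ i, 0 ≤ dissipation ρ (P.g i x) (P.g i xs) (lam i) (lams i) := fun i =>
    (sq_nonneg _).trans (sq_le_dissipation hρ (hK.feasible.1 i) (hK.nonneg i)
      (hK.complementary i))
  have h1 : ∑ i ∈ P.inactive xs, dissipation ρ (P.g i x) (P.g i xs) (lam i) (lams i) ≤
      P.totalDissipation ρ x xs lam lams :=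
    Finset.sum_le_sum_of_subset_of_nonneg (Finset.subset_univ _) fun i _ _ => hnn i
  have h2 : P.deltaMin xs ρ d₀ * ∑ i ∈ P.inactive xs, (lam - lams) i ^ 2 ≤
      2 * ∑ i ∈ P.inactive xs, dissipation ρ (P.g i x) (P.g i xs) (lam i) (lams i) := by
    rw [Finset.mul_sum, Finset.mul_sum]
    refine Finset.sum_le_sum fun i hi => ?_
    have hi' : P.g i xs ≠ 0 := by simpa [inactive] using hi
    have h0 := hK.eq_zero i hi'
    have h1 := (abs_apply_le_norm (lam - lams) i).trans hlam
    rw [PiLp.sub_apply, h0, sub_zero] at h1 ⊢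
    exact mul_sq_le_dissipation hρ (hK.feasible.1 i) h1 (P.deltaMin_le_one xs ρ d₀)
      fun hd => P.deltaMin_le hρ hd hi'
  linarith

theorem norm_sq_eq_inactive_add_activeSq (P : Problem n mI mE) (xs : E n) (u : E mI) (ν : E mE) :
    ‖u‖ ^ 2 + ‖ν‖ ^ 2 = ∑ i ∈ P.inactive xs, u i ^ 2 + P.activeSq xs u ν := by
  rw [activeSq, activeSet, inactive, EuclideanSpace.real_norm_sq_eq u,
    ← Finset.sum_filter_add_sum_filter_not Finset.univ (fun i => P.g i xs = 0)]
  ring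

end Problem

end AugPDGD

/-! ### Exponential decay from a differential inequality, by monotonicity of e^{rt} V(t). -/

theorem le_exp_mul_of_hasDerivWithinAt {V V' : ℝ → ℝ} {r : ℝ}
    (h : ∀ t, 0 ≤ t → HasDerivWithinAt V (V' t) (Ici 0) t)
    (h' : ∀ t, 0 ≤ t → V' t + r * V t ≤ 0) {t : ℝ} (ht : 0 ≤ t) :
    V t ≤ Real.exp (-(r * t)) * V 0 := by
  have hexp : ∀ t, HasDerivAt (fun s => Real.exp (r * s)) (Real.exp (r * t) * r) t := by
    intro t
    simpa using ((hasDerivAt_id t).const_mul r).exp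
  have hd : ∀ t, 0 ≤ t → HasDerivWithinAt (fun s => Real.exp (r * s) * V s)
      (Real.exp (r * t) * r * V t + Real.exp (r * t) * V' t) (Ici 0) t :=
    fun t ht => (hexp t).hasDerivWithinAt.mul (h t ht)
  have hanti : AntitoneOn (fun s => Real.exp (r * s) * V s) (Ici 0) := by
    apply antitoneOn_of_deriv_nonpos (convex_Ici 0)
    · exact fun t ht => (hd t ht).continuousWithinAt
    · exact fun t ht => ((hd t (interior_subset ht)).mono interior_subset).differentiableWithinAt
    · intro t ht
      rw [interior_Ici] at ht
      rw [((hd t (le_of_lt ht)).hasDerivAt (Ici_mem_nhds ht)).deriv]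
      have := mul_nonpos_of_nonneg_of_nonpos (Real.exp_pos (r * t)).le (h' t (le_of_lt ht))
      linarith
  have h1 := hanti (mem_Ici.2 le_rfl) (mem_Ici.2 ht) ht
  simp only [mul_zero, Real.exp_zero, one_mul] at h1
  rw [Real.exp_neg, inv_mul_eq_div, le_div_iff₀ (Real.exp_pos _)]
  linarith

/-! ### The Lyapunov function along a trajectory. -/

namespace AugPDGD

variable {n mI mE : ℕ}

namespace Problem

open scoped RealInnerProductSpace

/-- The squared distance of two points of `ℝ^n × ℝ^mI × ℝ^mE`. -/
noncomputable def distSq (x xs : E n) (lam lams : E mI) (ν νs : E mE) : ℝ :=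
  ‖x - xs‖ ^ 2 + ‖lam - lams‖ ^ 2 + ‖ν - νs‖ ^ 2

theorem distSq_nonneg (x xs : E n) (lam lams : E mI) (ν νs : E mE) :
    0 ≤ distSq x xs lam lams ν νs := by
  rw [distSq]; positivity

/-- `activeComb` as a sum of continuous linear maps. -/
theorem activeComb_eq_clm (P : Problem n mI mE) (xs : E n) (lam : E mI) (ν : E mE) :
    P.activeComb xs lam ν =
      (∑ i ∈ P.activeSet xs, (EuclideanSpace.proj i : E mI →L[ℝ] ℝ).smulRight
        (gradient (P.g i) xs)) lam + P.clmAT ν := by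
  rw [activeComb, clmAT_apply, _root_.sum_apply]
  rfl

theorem hasDerivWithinAt_activeComb (P : Problem n mI mE) (xs : E n) {lam : ℝ → E mI}
    {ν : ℝ → E mE} {lam' : E mI} {ν' : E mE} {s : Set ℝ} {t : ℝ}
    (hlam : HasDerivWithinAt lam lam' s t) (hν : HasDerivWithinAt ν ν' s t) :
    HasDerivWithinAt (fun τ => P.activeComb xs (lam τ) (ν τ)) (P.activeComb xs lam' ν') s t := by
  simp only [activeComb_eq_clm]
  exact ((ContinuousLinearMap.hasFDerivAt _).comp_hasDerivWithinAt t hlam).add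
    (P.clmAT.hasFDerivAt.comp_hasDerivWithinAt t hν)

variable {P : Problem n mI mE} {xs : E n} {lams : E mI} {νs : E mE} {ρ : ℝ} {x : ℝ → E n}
  {lam : ℝ → E mI} {ν : ℝ → E mE}

theorem IsTrajectory.hasDerivWithinAt_distSq (h : P.IsTrajectory ρ x lam ν) (xs : E n)
    (lams : E mI) (νs : E mE) {t : ℝ} (ht : 0 ≤ t) :
    HasDerivWithinAt (fun τ => distSq (x τ) xs (lam τ) lams (ν τ) νs)
      (2 * (⟪x t - xs, P.velX ρ (x t) (lam t) (ν t)⟫ + ⟪lam t - lams, P.velLam ρ (x t) (lam t)⟫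
        + ⟪ν t - νs, P.mulA (x t) - P.b⟫)) (Ici 0) t := by
  have h1 := ((h.deriv_x t ht).sub_const xs).norm_sq
  have h2 := ((h.deriv_lam t ht).sub_const lams).norm_sq
  have h3 := ((h.deriv_ν t ht).sub_const νs).norm_sq
  refine ((h1.add h2).add h3).congr_deriv ?_
  rw [velX, velLam]
  ring

theorem IsTrajectory.hasDerivWithinAt_cross (h : P.IsTrajectory ρ x lam ν) (xs : E n)
    (lams : E mI) (νs : E mE) {t : ℝ} (ht : 0 ≤ t) :
    HasDerivWithinAt (fun τ => ⟪x τ - xs, P.activeComb xs (lam τ - lams) (ν τ - νs)⟫)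
      (⟪x t - xs, P.activeComb xs (P.velLam ρ (x t) (lam t)) (P.mulA (x t) - P.b)⟫
        + ⟪P.velX ρ (x t) (lam t) (ν t), P.activeComb xs (lam t - lams) (ν t - νs)⟫)
      (Ici 0) t :=
  ((h.deriv_x t ht).sub_const xs).inner ℝ (P.hasDerivWithinAt_activeComb xs
    ((h.deriv_lam t ht).sub_const lams) ((h.deriv_ν t ht).sub_const νs))

theorem IsKKT.totalDissipation_nonneg (hK : P.IsKKT xs lams νs) (hρ : 0 < ρ) (y : E n)
    (l : E mI) : 0 ≤ P.totalDissipation ρ y xs l lams :=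
  (sq_nonneg _).trans (hK.sq_norm_augMult_sub_le hρ y l)

/-- The distance to a KKT point does not increase along a trajectory. -/
theorem IsTrajectory.distSq_le (h : P.IsTrajectory ρ x lam ν) (hK : P.IsKKT xs lams νs)
    (hf : Differentiable ℝ P.f) (hfc : ConvexOn ℝ univ P.f)
    (hg : ∀ i, Differentiable ℝ (P.g i)) (hgc : ∀ i, ConvexOn ℝ univ (P.g i)) (hρ : 0 < ρ)
    {t : ℝ} (ht : 0 ≤ t) :
    distSq (x t) xs (lam t) lams (ν t) νs ≤ distSq (x 0) xs (lam 0) lams (ν 0) νs := by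
  have h1 := le_exp_mul_of_hasDerivWithinAt (r := 0)
    (fun t ht => h.hasDerivWithinAt_distSq xs lams νs ht) (fun t ht => ?_) ht
  · simpa using h1
  · have h2 := hK.pairing_le hg hgc hρ (x t) (lam t) (ν t)
    have h3 := (strongConvexOn_zero.2 hfc).mul_norm_sq_le_inner_gradient_sub hf (x t) xs
    have h4 := div_nonneg (hK.totalDissipation_nonneg hρ (x t) (lam t)) hρ.le
    linarith

/-- An upper bound of the squared norm of the active matrix. -/
noncomputable def normBoundSq (P : Problem n mI mE) (xs : E n) : ℝ :=
  ∑ i ∈ P.activeSet xs, ‖gradient (P.g i) xs‖ ^ 2 + ‖P.A‖ ^ 2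

theorem normBoundSq_nonneg (P : Problem n mI mE) (xs : E n) : 0 ≤ P.normBoundSq xs := by
  rw [normBoundSq]
  exact add_nonneg (Finset.sum_nonneg fun _ _ => sq_nonneg _) (sq_nonneg _)

theorem normBoundSq_le {Lgi : Fin mI → ℝ≥0} (hLs : ∀ i, ‖gradient (P.g i) xs‖ ≤ Lgi i) :
    P.normBoundSq xs ≤ aggregate Lgi ^ 2 + ‖P.A‖ ^ 2 := by
  rw [normBoundSq, aggregate, Real.sq_sqrt (Finset.sum_nonneg fun _ _ => sq_nonneg _)]
  gcongr
  calc ∑ i ∈ P.activeSet xs, ‖gradient (P.g i) xs‖ ^ 2 ≤ ∑ i, ‖gradient (P.g i) xs‖ ^ 2 :=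
        Finset.sum_le_sum_of_subset_of_nonneg (Finset.subset_univ _) fun _ _ _ => sq_nonneg _
    _ ≤ ∑ i, (Lgi i : ℝ) ^ 2 :=
        Finset.sum_le_sum fun i _ => pow_le_pow_left₀ (norm_nonneg _) (hLs i) 2

theorem two_mul_abs_inner_activeComb_le (P : Problem n mI mE) (xs : E n) (y : E n) (l lams : E mI)
    (v νs : E mE) :
    2 * |⟪y - xs, P.activeComb xs (l - lams) (v - νs)⟫| ≤
      √(P.normBoundSq xs) * distSq y xs l lams v νs := by
  have h1 := abs_real_inner_le_norm (y - xs) (P.activeComb xs (l - lams) (v - νs))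
  have h2 := P.norm_activeComb_sq_le xs (l - lams) (v - νs)
  have h3 := P.norm_sq_eq_inactive_add_activeSq xs (l - lams) (v - νs)
  have h4 : 0 ≤ ∑ i ∈ P.inactive xs, (l - lams) i ^ 2 := Finset.sum_nonneg fun _ _ => sq_nonneg _
  set p := ‖P.activeComb xs (l - lams) (v - νs)‖
  set X := ‖y - xs‖ with hX
  set S := ‖l - lams‖ ^ 2 + ‖v - νs‖ ^ 2 with hS
  have hS0 : 0 ≤ S := by positivity
  have h5 : p ≤ √(P.normBoundSq xs) * √S := by
    rw [← Real.sqrt_mul (P.normBoundSq_nonneg xs)]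
    refine Real.le_sqrt_of_sq_le (h2.trans ?_)
    exact mul_le_mul_of_nonneg_left (by linarith) (P.normBoundSq_nonneg xs)
  have h6 : distSq y xs l lams v νs = X ^ 2 + √S ^ 2 := by
    rw [distSq, Real.sq_sqrt hS0, hS, add_assoc]
  rw [h6]
  have h7 := mul_le_mul_of_nonneg_left h5 (norm_nonneg (y - xs))
  have h8 : √(P.normBoundSq xs) * (2 * (X * √S)) ≤ √(P.normBoundSq xs) * (X ^ 2 + √S ^ 2) :=
    mul_le_mul_of_nonneg_left (by linarith [two_mul_le_add_sq X (√S)]) (Real.sqrt_nonneg _)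
  linarith

/-- The rate of the Lyapunov function `‖z - z*‖² + 2 c ⟨x - x*, Bᵀ y⟩`. -/
theorem IsTrajectory.lyapunov_le (h : P.IsTrajectory ρ x lam ν) (hK : P.IsKKT xs lams νs)
    (hf : Differentiable ℝ P.f) (hfc : ConvexOn ℝ univ P.f)
    (hg : ∀ i, Differentiable ℝ (P.g i)) (hgc : ∀ i, ConvexOn ℝ univ (P.g i)) (hρ : 0 < ρ)
    (hL : P.LICQ xs) (hrows : 0 < Fintype.card (P.Active xs) + mE)
    {μ : ℝ} {ℓ : ℝ≥0} (hμ : 0 < μ) (hfμ : StrongConvexOn univ μ P.f)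
    (hfℓ : LipschitzWith ℓ (gradient P.f)) {d₀ : ℝ}
    (hd₀ : d₀ = zdist (x 0) (lam 0) (ν 0) xs lams νs) {Lgi Mgi : Fin mI → ℝ≥0}
    (hLg : ∀ i, ∀ y ∈ Metric.closedBall xs d₀, ‖gradient (P.g i) y‖ ≤ Lgi i)
    (hMg : ∀ i, LipschitzOnWith (Mgi i) (gradient (P.g i)) (Metric.closedBall xs d₀))
    {β : ℝ} (hβ : 0 < β)
    (h1 : RateCond₁ β (P.kappa xs) (P.deltaMin xs ρ d₀) ρ (aggregate Lgi) ‖P.A‖)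
    (h2 : RateCond₂ β (P.kappa xs) μ ℓ ρ (aggregate Lgi) ‖P.A‖
      (MTheta ρ (aggregate Lgi) (aggregate Mgi) d₀ ‖lams‖)) {t : ℝ} (ht : 0 ≤ t) :
    distSq (x t) xs (lam t) lams (ν t) νs + 2 * (2 * β / P.kappa xs) *
        ⟪x t - xs, P.activeComb xs (lam t - lams) (ν t - νs)⟫ ≤
      Real.exp (-(2 * β * t)) * (distSq (x 0) xs (lam 0) lams (ν 0) νs
        + 2 * (2 * β / P.kappa xs) *
        ⟪x 0 - xs, P.activeComb xs (lam 0 - lams) (ν 0 - νs)⟫) := by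
  have hd0 : 0 ≤ d₀ := hd₀ ▸ Real.sqrt_nonneg _
  have hκ := hL.kappa_pos hrows
  have hxs : xs ∈ Metric.closedBall xs d₀ := Metric.mem_closedBall_self hd0
  have hLs : ∀ i, ‖gradient (P.g i) xs‖ ≤ Lgi i := fun i => hLg i xs hxs
  have hκL := (P.kappa_le xs hrows).trans (normBoundSq_le hLs)
  have hc0 : 0 < 2 * β / P.kappa xs := by positivity
  have hLa : 0 < aggregate Lgi ^ 2 + ‖P.A‖ ^ 2 := hκ.trans_le hκL
  -- The sign of δ_min is forced by a positive β satisfying the first rate condition.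
  have hδ0 : 0 ≤ P.deltaMin xs ρ d₀ := by
    rw [RateCond₁, le_div_iff₀ (by positivity)] at h1
    refine le_of_mul_le_mul_left ?_ hκ
    rw [mul_zero]
    exact le_trans (by positivity) h1
  have hagg : 0 ≤ aggregate Lgi := Real.sqrt_nonneg _
  have hagg' : 0 ≤ aggregate Mgi := Real.sqrt_nonneg _
  refine le_exp_mul_of_hasDerivWithinAt (r := 2 * β)
    (V := fun τ => distSq (x τ) xs (lam τ) lams (ν τ) νs + 2 * (2 * β / P.kappa xs) *
      ⟪x τ - xs, P.activeComb xs (lam τ - lams) (ν τ - νs)⟫)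
    (fun t ht => (h.hasDerivWithinAt_distSq xs lams νs ht).add
      ((h.hasDerivWithinAt_cross xs lams νs ht).const_mul (2 * (2 * β / P.kappa xs))))
    (fun t ht => ?_) ht
  have hle := h.distSq_le hK hf hfc hg hgc hρ ht
  have hd₀' : distSq (x 0) xs (lam 0) lams (ν 0) νs = d₀ ^ 2 := by
    rw [hd₀]
    exact (Real.sq_sqrt (distSq_nonneg (x 0) xs (lam 0) lams (ν 0) νs)).symm
  rw [hd₀'] at hle
  have hx : ‖x t - xs‖ ≤ d₀ := by
    refine (sq_le_sq₀ (norm_nonneg _) hd0).1 ?_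
    rw [distSq] at hle
    linarith [sq_nonneg ‖lam t - lams‖, sq_nonneg ‖ν t - νs‖]
  have hlam : ‖lam t - lams‖ ≤ d₀ := by
    refine (sq_le_sq₀ (norm_nonneg _) hd0).1 ?_
    rw [distSq] at hle
    linarith [sq_nonneg ‖x t - xs‖, sq_nonneg ‖ν t - νs‖]
  have hxt : x t ∈ Metric.closedBall xs d₀ := by rwa [mem_closedBall_iff_norm]
  have hpair := hK.pairing_le hg hgc hρ (x t) (lam t) (ν t)
  have hcross1 := hK.inner_velX_activeComb_le (Mgi := Mgi) hρ (ν t) hx hlam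
    (fun i => abs_sub_le_of_gradient_le (hg i) (hgc i) (hLg i _ hxt) (hLs i)) hLs
    (fun i => (hMg i).norm_sub_le hxt hxs)
  have hcross2 := hK.inner_activeComb_velLam_le hρ (x t) (lam t) hLs
  have hsplit := P.norm_sq_eq_inactive_add_activeSq xs (lam t - lams) (ν t - νs)
  have hcross := mul_le_mul_of_nonneg_left (add_le_add hcross2 hcross1)
    (mul_nonneg zero_le_two hc0.le)
  have key := lyapunov_decay (M := (ρ * aggregate Lgi * d₀ + d₀ + ‖lams‖) * aggregate Mgi)
    (X := ‖x t - xs‖) (s := ⟪gradient P.f (x t) - gradient P.f xs, x t - xs⟫)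
    (z := ⟪x t - xs, P.activeComb xs (lam t - lams) (ν t - νs)⟫)
    hβ hκ hμ ℓ.2 hρ (by positivity) hκL rfl (P.deltaMin_le_one xs ρ d₀) h1 h2
    (hfμ.mul_norm_sq_le_inner_gradient_sub hf (x t) xs)
    (hfc.norm_sq_gradient_sub_le hfℓ hf (x t) xs)
    (P.kappa_mul_activeSq_le xs (lam t - lams) (ν t - νs))
    (real_inner_le_norm _ _)
    (hK.sq_norm_augMult_sub_le hρ (x t) (lam t))
    (hK.deltaMin_mul_residual_le hρ (x t) hlam hδ0)
    (Finset.sum_nonneg fun _ _ => sq_nonneg _)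
    (hK.deltaMin_mul_inactive_le hρ (x t) hlam)
    (D := 2 * (⟪x t - xs, P.velX ρ (x t) (lam t) (ν t)⟫
        + ⟪lam t - lams, P.velLam ρ (x t) (lam t)⟫ + ⟪ν t - νs, P.mulA (x t) - P.b⟫)
      + 2 * (2 * β / P.kappa xs) *
        (⟪x t - xs, P.activeComb xs (P.velLam ρ (x t) (lam t)) (P.mulA (x t) - P.b)⟫
        + ⟪P.velX ρ (x t) (lam t) (ν t), P.activeComb xs (lam t - lams) (ν t - νs)⟫))
    (by
      refine (add_le_add (mul_le_mul_of_nonneg_left hpair zero_le_two) hcross).trans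
        (le_of_eq ?_)
      ring)
  have hV : distSq (x t) xs (lam t) lams (ν t) νs =
      ‖x t - xs‖ ^ 2 + ∑ i ∈ P.inactive xs, (lam t - lams) i ^ 2
        + P.activeSq xs (lam t - lams) (ν t - νs) := by
    rw [distSq, add_assoc, hsplit, add_assoc]
  simp only [hV]
  exact key

/-! ### Comparison of the Lyapunov function with the squared distance. -/

theorem LICQ.le_of_strongConvexOn (hL : P.LICQ xs)
    (hrows : 0 < Fintype.card (P.Active xs) + mE) (hf : Differentiable ℝ P.f) {μ : ℝ} {ℓ : ℝ≥0}
    (hfμ : StrongConvexOn univ μ P.f) (hfℓ : LipschitzWith ℓ (gradient P.f)) : μ ≤ ℓ := by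
  -- Comparing μ with ℓ needs a nonzero vector in the primal space; LICQ with at least one row
  -- supplies Bᵀy.
  obtain ⟨l, v, hlv⟩ := P.exists_activeSq_pos xs hrows
  have h1 : 0 < ‖P.activeComb xs l v‖ ^ 2 :=
    (mul_pos (hL.kappa_pos hrows) hlv).trans_le (P.kappa_mul_activeSq_le xs l v)
  set T := P.activeComb xs l v
  have h2 := hfμ.mul_norm_sq_le_inner_gradient_sub hf T 0
  have h3 := real_inner_le_norm (gradient P.f T - gradient P.f 0) (T - 0)
  have h4 := mul_le_mul_of_nonneg_right (hfℓ.norm_sub_le T 0) (norm_nonneg (T - 0))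
  rw [sub_zero] at h2 h3 h4
  refine le_of_mul_le_mul_right ?_ h1
  linarith

/-- The coupling of the Lyapunov function, relative to the squared distance. -/
noncomputable def coupling (P : Problem n mI mE) (xs : E n) (β : ℝ) : ℝ :=
  2 * β / P.kappa xs * √(P.normBoundSq xs)

/-- The factor in front of the exponential. -/
noncomputable def overshoot (P : Problem n mI mE) (xs : E n) (β : ℝ) : ℝ :=
  -- The rate conditions force the coupling below 1/4, so the default 1 only keeps the factor
  -- positive for other β. The gradients are taken at x* and not bounded by L_g, hence the factor
  -- depends on the problem alone.
  if P.coupling xs β < 1 then √((1 + P.coupling xs β) / (1 - P.coupling xs β)) else 1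

theorem overshoot_pos (hκ : 0 < P.kappa xs) {β : ℝ} (hβ : 0 < β) : 0 < P.overshoot xs β := by
  have h0 : 0 ≤ P.coupling xs β := by rw [coupling]; positivity
  rw [overshoot]
  split_ifs with h
  · exact Real.sqrt_pos.2 (div_pos (by linarith) (by linarith))
  · exact one_pos

theorem tendsto_overshoot (P : Problem n mI mE) (xs : E n) :
    Tendsto (P.overshoot xs) (𝓝[>] 0) (𝓝 1) := by
  have hc : Tendsto (P.coupling xs) (𝓝[>] 0) (𝓝 0) := by
    have h1 : Continuous (P.coupling xs) := by unfold coupling; fun_prop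
    have h2 := (h1.tendsto 0).mono_left (nhdsWithin_le_nhds (s := Ioi 0))
    simpa [coupling] using h2
  have h3 : Tendsto (fun s : ℝ => √((1 + s) / (1 - s))) (𝓝 0) (𝓝 1) := by
    have : ContinuousAt (fun s : ℝ => √((1 + s) / (1 - s))) 0 := by
      refine ContinuousAt.sqrt (ContinuousAt.div ?_ ?_ (by norm_num)) <;> fun_prop
    simpa [ContinuousAt] using this
  refine (h3.comp hc).congr' ?_
  filter_upwards [hc.eventually_lt_const one_pos] with β hβ
  rw [overshoot, if_pos hβ, Function.comp]

end Problem

/-- The second rate condition dominates b² + μ² ≥ 2bμ, where μ ≤ ℓ covers μ²; hence 2cbμ ≤ μ/2 with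
c = 2β/κ. -/
theorem RateCond₂.coupling_le {ρ β κ μ ℓ L a M b : ℝ} (hρ : 0 < ρ)
    (h : RateCond₂ β κ μ ℓ ρ L a M) (hβ : 0 < β) (hκ : 0 < κ) (hμ : 0 < μ) (hμℓ : μ ≤ ℓ)
    (hM : 0 ≤ M) (hb : b ^ 2 ≤ L ^ 2 + a ^ 2) : 2 * β / κ * b ≤ 1 / 4 := by
  have h1 := h.mul_le hβ hκ rfl
  have hc0 : 0 < 2 * β / κ := by positivity
  have h2 : μ * μ ≤ (ℓ + M) * (μ + M + 1 / ρ) := by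
    have : 0 < 1 / ρ := by positivity
    gcongr <;> linarith
  have h3 : 2 * b * μ ≤ 4 * β ^ 2 + a ^ 2 + L ^ 2 + κ / 4 + (ℓ + M) * (μ + M + 1 / ρ)
      + 1 / (2 * ρ ^ 2) := by
    have h4 : 0 ≤ 1 / (2 * ρ ^ 2) := by positivity
    linarith [two_mul_le_add_sq b μ, sq_nonneg β]
  have h5 := mul_le_mul_of_nonneg_left h3 hc0.le
  refine le_of_mul_le_mul_right ?_ hμ
  linarith

end AugPDGD

theorem theorem1 {n mI mE : ℕ} (P : AugPDGD.Problem n mI mE)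
    (hf : ContDiff ℝ 1 P.f) (hfconv : ConvexOn ℝ univ P.f)
    (hg : ∀ i, ContDiff ℝ 1 (P.g i)) (hgconv : ∀ i, ConvexOn ℝ univ (P.g i))
    (xs : AugPDGD.E n) (hxs : P.IsSolution xs)
    (hLICQ : P.LICQ xs) (hrows : 0 < Fintype.card (P.Active xs) + mE) :
    ∃ (lams : AugPDGD.E mI) (νs : AugPDGD.E mE),
      P.IsKKT xs lams νs ∧
      (∀ (lam : AugPDGD.E mI) (ν : AugPDGD.E mE),
        P.IsKKT xs lam ν → lam = lams ∧ ν = νs) ∧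
      ∃ M : ℝ → ℝ, (∀ β, 0 < β → 0 < M β) ∧ Tendsto M (𝓝[>] 0) (𝓝 1) ∧
        ∀ (μ : ℝ) (ℓ : ℝ≥0) (ρ : ℝ), 0 < μ → 0 < ρ →
          StrongConvexOn univ μ P.f → LipschitzWith ℓ (gradient P.f) →
          ∀ (x : ℝ → AugPDGD.E n) (lam : ℝ → AugPDGD.E mI) (ν : ℝ → AugPDGD.E mE),
            P.IsTrajectory ρ x lam ν → (∀ i, 0 ≤ lam 0 i) →
            ∀ d₀ : ℝ, d₀ = AugPDGD.zdist (x 0) (lam 0) (ν 0) xs lams νs →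
            ∀ Lgi Mgi : Fin mI → ℝ≥0,
              (∀ i, ∀ y ∈ Metric.closedBall xs d₀, ‖gradient (P.g i) y‖ ≤ Lgi i) →
              (∀ i, LipschitzOnWith (Mgi i) (gradient (P.g i)) (Metric.closedBall xs d₀)) →
              ∀ β : ℝ, 0 < β →
                AugPDGD.RateCond₁ β (P.kappa xs) (P.deltaMin xs ρ d₀) ρ
                  (AugPDGD.aggregate Lgi) ‖P.A‖ →
                AugPDGD.RateCond₂ β (P.kappa xs) μ ℓ ρ (AugPDGD.aggregate Lgi) ‖P.A‖
                  (AugPDGD.MTheta ρ (AugPDGD.aggregate Lgi) (AugPDGD.aggregate Mgi)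
                    d₀ ‖lams‖) →
                ∀ t : ℝ, 0 ≤ t →
                  AugPDGD.zdist (x t) (lam t) (ν t) xs lams νs ≤
                    M β * Real.exp (-β * t) * d₀ := by
  have hfd : Differentiable ℝ P.f := hf.differentiable one_ne_zero
  have hgd : ∀ i, Differentiable ℝ (P.g i) := fun i => (hg i).differentiable one_ne_zero
  have hκ := hLICQ.kappa_pos hrows
  obtain ⟨lams, νs, hK⟩ := hxs.exists_isKKT hfd hgd hLICQ
  refine ⟨lams, νs, hK, fun l v h => hLICQ.isKKT_unique hrows h hK, P.overshoot xs,
    fun β hβ => AugPDGD.Problem.overshoot_pos hκ hβ, P.tendsto_overshoot xs, ?_⟩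
  intro μ ℓ ρ hμ hρ hfμ hfℓ x lam ν htraj _ d₀ hd₀ Lgi Mgi hLg hMg β hβ h1 h2 t ht
  have hlyap := htraj.lyapunov_le hK hfd hfconv hgd hgconv hρ hLICQ hrows hμ hfμ hfℓ hd₀ hLg hMg
    hβ h1 h2 ht
  have hd0 : 0 ≤ d₀ := hd₀ ▸ Real.sqrt_nonneg _
  have hLs : ∀ i, ‖gradient (P.g i) xs‖ ≤ Lgi i :=
    fun i => hLg i xs (Metric.mem_closedBall_self hd0)
  have hs : P.coupling xs β ≤ 1 / 4 := by
    have hM : 0 ≤ AugPDGD.MTheta ρ (AugPDGD.aggregate Lgi) (AugPDGD.aggregate Mgi) d₀ ‖lams‖ := by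
      have h3 : 0 ≤ AugPDGD.aggregate Lgi := Real.sqrt_nonneg _
      have h4 : 0 ≤ AugPDGD.aggregate Mgi := Real.sqrt_nonneg _
      rw [AugPDGD.MTheta]
      positivity
    refine AugPDGD.RateCond₂.coupling_le hρ h2 hβ hκ hμ
      (hLICQ.le_of_strongConvexOn hrows hfd hfμ hfℓ) hM ?_
    rw [Real.sq_sqrt (P.normBoundSq_nonneg xs)]
    exact AugPDGD.Problem.normBoundSq_le hLs
  have hc : 0 < 2 * β / P.kappa xs := by positivity
  have hbd : ∀ (y : AugPDGD.E n) (l : AugPDGD.E mI) (v : AugPDGD.E mE),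
      |2 * (2 * β / P.kappa xs) *
        inner ℝ (y - xs) (P.activeComb xs (l - lams) (v - νs))| ≤
      P.coupling xs β * AugPDGD.Problem.distSq y xs l lams v νs := by
    intro y l v
    have h3 := mul_le_mul_of_nonneg_left
      (P.two_mul_abs_inner_activeComb_le xs y l lams v νs) hc.le
    rw [abs_mul, abs_of_pos (by positivity : 0 < 2 * (2 * β / P.kappa xs)),
      AugPDGD.Problem.coupling]
    linarith
  have h3 := (abs_le.1 (hbd (x t) (lam t) (ν t))).1
  have h4 := (abs_le.1 (hbd (x 0) (lam 0) (ν 0))).2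
  have hz : ∀ τ, AugPDGD.zdist (x τ) (lam τ) (ν τ) xs lams νs =
      √(AugPDGD.Problem.distSq (x τ) xs (lam τ) lams (ν τ) νs) := fun τ => rfl
  have hd₀' : AugPDGD.Problem.distSq (x 0) xs (lam 0) lams (ν 0) νs = d₀ ^ 2 := by
    rw [hd₀, hz, Real.sq_sqrt (AugPDGD.Problem.distSq_nonneg _ _ _ _ _ _)]
  rw [hd₀'] at h4 hlyap
  rw [hz, AugPDGD.Problem.overshoot, if_pos (by linarith)]
  set s := P.coupling xs β
  have hexp : Real.exp (-(2 * β * t)) = Real.exp (-β * t) ^ 2 := by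
    rw [← Real.exp_nat_mul]; congr 1; push_cast; ring
  rw [hexp] at hlyap
  -- Bounding V below at time t and above at time 0 gives (1 - s)‖z(t) - z*‖² ≤ e^{-2βt}(1 + s)d₀².
  have h5 := mul_le_mul_of_nonneg_left (add_le_add_right h4 (d₀ ^ 2))
    (sq_nonneg (Real.exp (-β * t)))
  have h6 : AugPDGD.Problem.distSq (x t) xs (lam t) lams (ν t) νs ≤
      (1 + s) / (1 - s) * (Real.exp (-β * t) * d₀) ^ 2 := by
    rw [div_mul_eq_mul_div, le_div_iff₀ (by linarith)]
    linarith
  refine (Real.sqrt_le_sqrt h6).trans (le_of_eq ?_)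
  rw [Real.sqrt_mul' _ (sq_nonneg _), Real.sqrt_sq (by positivity), mul_assoc]
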